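/- Let $(M^{2n},\omega,\lambda)$, $n\ge 1$, $\omega=d\lambda$, be an exact symplectic manifold with (possibly empty) boundary, $J$ an almost complex structure such that $g=\omega(\cdot,J\cdot)$ is a Riemannian metric, $f\colon M\to\mathbb C$ a smooth $J$-holomorphic function ($df\circ J=i\,df$), and $z_0\in\mathbb C$. Assume: (P1) $f$ is proper and has finitely many critical points; these are non-degenerate and lie in pairwise different fibres, and $J$ is integrable near each of them. (P2) $\partial M$ is weakly $J$-convex: there is a continuous function $h\colon M\to(-\infty,0]$ with $h^{-1}(0)=\partial M$ which is $J$-plurisubharmonic in a neighbourhood $O$ of $\partial M$, i.e. $h\circ v$ is subharmonic for every $J$-holomorphic map $v$ from an open subset of $\mathbb C$ to $O$. (P3) $z_0$ is a regular value of $f$, and with $M_0=f^{-1}(z_0)$ and $\partial M_0=M_0\cap\partial M$ there are compact sets $K\subset M\setminus\partial M$, $K'\subset (M_0\setminus\partial M_0)\times\mathbb C$ and a number $r>0$ such that, with $V=M\setminus K$, $V'=(M_0\times\mathbb C)\setminus K'$ and $\lambda_0=\mathrm{Re}(iz\,d\bar z)$: (a) each $z\in\mathbb C$ has a disc $B_\delta(z)$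 and a diffeomorphism $\psi_z\colon V'\cap (M_0\times B_\delta(z))\to V\cap f^{-1}(B_\delta(z))$ with $f\circ\psi_z=\mathrm{pr}_2$, which is the identity on $V'\cap(M_0\times\{z_0\})$ if $z_0\in B_\delta(z)$, such that $\psi_z^*\lambda=\lambda|_{M_0}+r\lambda_0$ and such that $\psi_z^*J$ is split: at each point it is the direct sum of a complex structure on the tangent space of the fibre (which may depend on the point of $B_\delta(z)$) and of the standard complex structure of $\mathbb C$; (b) there are a neighbourhood $W$ of $\partial M$ in $M$, a neighbourhood $W'$ of $\partial M_0\times\mathbb C$ in $M_0\times \mathbb C$ and a diffeomorphism $\psi\colon W'\to W$ with $f\circ\psi=\mathrm{pr}_2$, $\psi^*\lambda=\lambda|_{M_0}+r\lambda_0$ and $\psi^*J=J|_{M_0}\times i$. (H1) No critical value of $f$ lies in the convex hull of the other critical values, and $z_0$ lies in the interior of the convex hull of all critical values. Let $m_-,m_+$ be critical points of $f$ and let $\alpha\in\mathbb R$ be such that the function $\tilde f=e^{-i\alpha}(f-z_0)$ satisfies $\mathrm{Im}\,\tilde f(m_-)=\mathrm{Im}\,\tilde f(m_+)>0$. Put $\theta_\pm=\arg\tilde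 f(m_\pm)\in(0,\pi)$, $v_0=\mathrm{grad}\,\mathrm{Re}\,\tilde f$, $v_1=\mathrm{grad}\,\mathrm{Im}\,\tilde f$. Let $\nu\in(0,1)$ and let $\theta_\nu\colon\mathbb R\to\mathbb R$ be a smooth function such that $\theta_\nu(t)=0$ for $|t|\ge\nu^{-1}+1$, $\theta_\nu=\theta_+$ on $[-\nu^{-1},-\nu]$, $\theta_\nu=\theta_--\pi$ on $[\nu,\nu^{-1}]$, $\theta_\nu$ is monotone on each of the intervals $(-\nu^{-1}-1,-\nu^{-1})$, $(-\nu,\nu)$, $(\nu^{-1},\nu^{-1}+1)$, $\theta_\nu\ge 0$ on $(-\infty,0]$ and $\theta_\nu\le 0$ on $[0,\infty)$. Then there is a compact set $\hat K\subset M\setminus\partial M$ with the following property. Let $\gamma_\pm\colon\mathbb R\to M$ be any solutions of $$\dot\gamma+\cos\theta_\nu(t)\,v_0(\gamma)+\sin\theta_\nu(t)\,v_1(\gamma)=0,\qquad \lim_{t\to\pm\infty}\gamma(t)=m_\mp,$$ and let $u\colon\mathbb R^2\to M$ be any $C^1$ solution of $$\partial_su+J\bigl(\partial_tu+\cos\theta_\nu(t)\,v_0(u)+\sin\theta_\nu(t)\,v_1(u)\bigr)=0$$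 with $\lim_{t\to\pm\infty}u(s,t)=m_\mp$ uniformly in $s$ and $\lim_{s\to\pm\infty}u(s,t)=\gamma_\mp(t)$ uniformly in $t$. Then $u(\mathbb R^2)\subset\hat K$. -/

import Mathlib

open Set Filter Topology
open scoped Manifold ContDiff

noncomputable section

namespace LefschetzFloer

variable {n : ℕ} [NeZero n] {M : Type*} [TopologicalSpace M]
  [ChartedSpace (EuclideanHalfSpace (2 * n)) M]

/-! ### Differential forms, almost complex structures and the metric

`M` is a `2n`-dimensional manifold with (possibly empty) boundary, modelled on the half space.
In Mathlib the tangent space `TangentSpace (𝓡∂ (2 * n)) x` is the model vector space, identified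
through the preferred chart at `x`. -/

/-- Smoothness of a one-form, as a section of the cotangent bundle. -/
def SmoothOneForm [IsManifold (𝓡∂ (2 * n)) ∞ M]
    (lam : (x : M) → TangentSpace (𝓡∂ (2 * n)) x →L[ℝ] ℝ) : Prop :=
  ContMDiff (𝓡∂ (2 * n)) ((𝓡∂ (2 * n)).prod 𝓘(ℝ, EuclideanSpace ℝ (Fin (2 * n)) →L[ℝ] ℝ)) ∞
    (fun x => Bundle.TotalSpace.mk' (EuclideanSpace ℝ (Fin (2 * n)) →L[ℝ] ℝ)
      (E := fun x : M => TangentSpace (𝓡∂ (2 * n)) x →L[ℝ] ℝ) x (lam x))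

/-- Smoothness of a field of endomorphisms, as a section of `End TM`. -/
def SmoothEndomorphismField [IsManifold (𝓡∂ (2 * n)) ∞ M]
    (J : (x : M) → TangentSpace (𝓡∂ (2 * n)) x →L[ℝ] TangentSpace (𝓡∂ (2 * n)) x) : Prop :=
  ContMDiff (𝓡∂ (2 * n))
    ((𝓡∂ (2 * n)).prod
      𝓘(ℝ, EuclideanSpace ℝ (Fin (2 * n)) →L[ℝ] EuclideanSpace ℝ (Fin (2 * n)))) ∞
    (fun x => Bundle.TotalSpace.mk'
      (EuclideanSpace ℝ (Fin (2 * n)) →L[ℝ] EuclideanSpace ℝ (Fin (2 * n)))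
      (E := fun x : M => TangentSpace (𝓡∂ (2 * n)) x →L[ℝ] TangentSpace (𝓡∂ (2 * n)) x) x (J x))

/-- The one-form `lam` read in the preferred chart at `x₀`, i.e. its pull-back under the inverse
of that chart. -/
def oneFormInChart (lam : (x : M) → TangentSpace (𝓡∂ (2 * n)) x →L[ℝ] ℝ) (x₀ : M)
    (y : EuclideanSpace ℝ (Fin (2 * n))) : EuclideanSpace ℝ (Fin (2 * n)) →L[ℝ] ℝ :=
  (lam ((extChartAt (𝓡∂ (2 * n)) x₀).symm y)).comp
    (mfderivWithin 𝓘(ℝ, EuclideanSpace ℝ (Fin (2 * n))) (𝓡∂ (2 * n))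
      (extChartAt (𝓡∂ (2 * n)) x₀).symm (range (𝓡∂ (2 * n))) y)

/-- The exterior derivative `ω = dλ` at `x`:
`dλ(v, w) = (D_v λ)(w) - (D_w λ)(v)` in the preferred chart at `x`. -/
def omega (lam : (x : M) → TangentSpace (𝓡∂ (2 * n)) x →L[ℝ] ℝ) (x : M)
    (v w : TangentSpace (𝓡∂ (2 * n)) x) : ℝ :=
  fderivWithin ℝ (oneFormInChart lam x) (range (𝓡∂ (2 * n)))
      (extChartAt (𝓡∂ (2 * n)) x x) (v : EuclideanSpace ℝ (Fin (2 * n)))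
      (w : EuclideanSpace ℝ (Fin (2 * n)))
    - fderivWithin ℝ (oneFormInChart lam x) (range (𝓡∂ (2 * n)))
      (extChartAt (𝓡∂ (2 * n)) x x) (w : EuclideanSpace ℝ (Fin (2 * n)))
      (v : EuclideanSpace ℝ (Fin (2 * n)))

/-- The bilinear form `g(v, w) = ω(v, J w)`. -/
def metric (lam : (x : M) → TangentSpace (𝓡∂ (2 * n)) x →L[ℝ] ℝ)
    (J : (x : M) → TangentSpace (𝓡∂ (2 * n)) x →L[ℝ] TangentSpace (𝓡∂ (2 * n)) x) (x : M)
    (v w : TangentSpace (𝓡∂ (2 * n)) x) : ℝ :=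
  omega lam x v (J x w)

/-- `(M, dλ, λ)` is an exact symplectic manifold and `J` is an almost complex structure such that
`g = ω(·, J ·)` is a Riemannian metric. (Non-degeneracy of `ω = dλ` follows from positivity
of `g`; orthogonality of `J` follows from the symmetry of `g`.) -/
structure IsExactAlmostKahler [IsManifold (𝓡∂ (2 * n)) ∞ M]
    (lam : (x : M) → TangentSpace (𝓡∂ (2 * n)) x →L[ℝ] ℝ)
    (J : (x : M) → TangentSpace (𝓡∂ (2 * n)) x →L[ℝ] TangentSpace (𝓡∂ (2 * n)) x) : Prop where
  smooth_lam : SmoothOneForm lam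
  smooth_J : SmoothEndomorphismField J
  J_sq : ∀ (x : M) (v : TangentSpace (𝓡∂ (2 * n)) x), J x (J x v) = -v
  metric_symm : ∀ (x : M) (v w : TangentSpace (𝓡∂ (2 * n)) x),
    metric lam J x v w = metric lam J x w v
  metric_pos : ∀ (x : M) (v : TangentSpace (𝓡∂ (2 * n)) x), v ≠ 0 → 0 < metric lam J x v v

/-- The gradient of `φ` with respect to `g = ω(·, J ·)`: the vector `v` with
`g(v, w) = dφ(w)` for all `w` (it exists and is unique because `g` is positive definite). -/
def grad (lam : (x : M) → TangentSpace (𝓡∂ (2 * n)) x →L[ℝ] ℝ)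
    (J : (x : M) → TangentSpace (𝓡∂ (2 * n)) x →L[ℝ] TangentSpace (𝓡∂ (2 * n)) x)
    (φ : M → ℝ) (x : M) : TangentSpace (𝓡∂ (2 * n)) x :=
  Classical.epsilon fun v : TangentSpace (𝓡∂ (2 * n)) x =>
    ∀ w : TangentSpace (𝓡∂ (2 * n)) x,
      metric lam J x v w = mfderiv (𝓡∂ (2 * n)) 𝓘(ℝ, ℝ) φ x w

variable (n) in
/-- The differential of a complex valued function at `x`. -/
def dC (f : M → ℂ) (x : M) : TangentSpace (𝓡∂ (2 * n)) x →L[ℝ] ℂ :=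
  mfderiv (𝓡∂ (2 * n)) 𝓘(ℝ, ℂ) f x

/-- The differential at `x` of a map to `ℂⁿ`. -/
def dCoord (ζ : M → (Fin n → ℂ)) (x : M) : TangentSpace (𝓡∂ (2 * n)) x →L[ℝ] (Fin n → ℂ) :=
  mfderiv (𝓡∂ (2 * n)) 𝓘(ℝ, Fin n → ℂ) ζ x

/-- `f : M → ℂ` is a smooth `J`-holomorphic function: `df ∘ J = i df`. -/
structure IsHolomorphicFunction
    (J : (x : M) → TangentSpace (𝓡∂ (2 * n)) x →L[ℝ] TangentSpace (𝓡∂ (2 * n)) x)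
    (f : M → ℂ) : Prop where
  smooth : ContMDiff (𝓡∂ (2 * n)) 𝓘(ℝ, ℂ) ∞ f
  holomorphic : ∀ (x : M) (v : TangentSpace (𝓡∂ (2 * n)) x),
    dC n f x (J x v) = Complex.I * dC n f x v

/-! ### Critical points -/

variable (n) in
/-- The set of critical points of `f`. -/
def critSet (f : M → ℂ) : Set M :=
  {x | dC n f x = 0}

variable (n) in
/-- The Hessian of `f` at `x`, in the preferred chart at `x`, has trivial kernel. -/
def NondegenerateAt (f : M → ℂ) (x : M) : Prop :=
  ∀ v : EuclideanSpace ℝ (Fin (2 * n)),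
    (∀ w : EuclideanSpace ℝ (Fin (2 * n)),
      fderivWithin ℝ
        (fun y => fderivWithin ℝ (f ∘ (extChartAt (𝓡∂ (2 * n)) x).symm) (range (𝓡∂ (2 * n))) y)
        (range (𝓡∂ (2 * n))) (extChartAt (𝓡∂ (2 * n)) x x) v w = 0) → v = 0

/-- `J` is integrable near `x`: there are complex coordinates
`ζ = (ζ₁, …, ζₙ)` near `x` with `dζ ∘ J = i dζ`. -/
def IntegrableNear
    (J : (x : M) → TangentSpace (𝓡∂ (2 * n)) x →L[ℝ] TangentSpace (𝓡∂ (2 * n)) x)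
    (x : M) : Prop :=
  ∃ (U : Set M) (ζ : M → (Fin n → ℂ)), IsOpen U ∧ x ∈ U ∧
    ContMDiffOn (𝓡∂ (2 * n)) 𝓘(ℝ, Fin n → ℂ) ∞ ζ U ∧
    ∀ y ∈ U, Function.Bijective (dCoord ζ y) ∧
      ∀ v : TangentSpace (𝓡∂ (2 * n)) y, dCoord ζ y (J y v) = Complex.I • dCoord ζ y v

/-- `f` is proper, with finitely many non-degenerate critical points lying in pairwise different
fibres, and `J` is integrable near each of them. -/
structure ProperMorse
    (J : (x : M) → TangentSpace (𝓡∂ (2 * n)) x →L[ℝ] TangentSpace (𝓡∂ (2 * n)) x)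
    (f : M → ℂ) : Prop where
  proper : IsProperMap f
  finite : (critSet n f).Finite
  nondegenerate : ∀ x ∈ critSet n f, NondegenerateAt n f x
  different_fibres : InjOn f (critSet n f)
  integrable : ∀ x ∈ critSet n f, IntegrableNear J x

/-! ### Weak `J`-convexity of the boundary -/

/-- `v : Ω → M` is a `J`-holomorphic map on `Ω ⊆ ℂ`. -/
structure IsHolomorphicCurve
    (J : (x : M) → TangentSpace (𝓡∂ (2 * n)) x →L[ℝ] TangentSpace (𝓡∂ (2 * n)) x)
    (Ω : Set ℂ) (v : ℂ → M) : Prop where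
  contMDiffOn : ContMDiffOn 𝓘(ℝ, ℂ) (𝓡∂ (2 * n)) 1 v Ω
  holomorphic : ∀ z ∈ Ω, ∀ ξ : ℂ,
    mfderiv 𝓘(ℝ, ℂ) (𝓡∂ (2 * n)) v z (Complex.I * ξ : ℂ)
      = J (v z) (mfderiv 𝓘(ℝ, ℂ) (𝓡∂ (2 * n)) v z (ξ : ℂ))

/-- A (continuous) function `h` is `J`-plurisubharmonic on `O`: its restriction to each
`J`-holomorphic curve in `O` is subharmonic, i.e. satisfies the sub-mean value inequality. -/
def PlurisubharmonicOn
    (J : (x : M) → TangentSpace (𝓡∂ (2 * n)) x →L[ℝ] TangentSpace (𝓡∂ (2 * n)) x)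
    (h : M → ℝ) (O : Set M) : Prop :=
  ∀ (Ω : Set ℂ) (v : ℂ → M), IsOpen Ω → IsHolomorphicCurve J Ω v → MapsTo v Ω O →
    ∀ (z : ℂ) (R : ℝ), 0 < R → Metric.closedBall z R ⊆ Ω →
      h (v z) ≤ Real.circleAverage (fun ζ => h (v ζ)) z R

/-- The boundary of `M` is weakly `J`-convex: it is the zero level set of a function
`h : M → (-∞, 0]` which is (not necessarily strictly) plurisubharmonic near the boundary. -/
def WeaklyConvexBoundary
    (J : (x : M) → TangentSpace (𝓡∂ (2 * n)) x →L[ℝ] TangentSpace (𝓡∂ (2 * n)) x) : Prop :=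
  ∃ h : M → ℝ, Continuous h ∧ (∀ x, h x ≤ 0) ∧
    (∀ x, h x = 0 ↔ x ∈ (𝓡∂ (2 * n)).boundary M) ∧
    ∃ O : Set M, IsOpen O ∧ (𝓡∂ (2 * n)).boundary M ⊆ O ∧ PlurisubharmonicOn J h O

/-! ### Triviality outside of a compact subset -/

/-- Let `M₀ = f⁻¹(z₀)`. The maps `ψ` and `(p, f)` are mutually inverse diffeomorphisms between
`D' ⊆ M₀ × ℂ` and `D ⊆ M` which commute with the projections to `ℂ`, and the pull-back of `λ` by
`ψ` is `λ|_{M₀} + r λ_0`, where `λ_0 = Re (i z dz̄)`. The last condition is written on `D`, where it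
reads `λ = p^* λ + r f^* λ_0`. -/
structure IsFibreTrivialization
    (lam : (x : M) → TangentSpace (𝓡∂ (2 * n)) x →L[ℝ] ℝ) (f : M → ℂ) (z₀ : ℂ) (r : ℝ)
    (D : Set M) (D' : Set (M × ℂ)) (p : M → M) (ψ : M × ℂ → M) : Prop where
  subset_fibre : ∀ q ∈ D', f q.1 = z₀
  mapsTo : ∀ x ∈ D, (p x, f x) ∈ D'
  mapsTo_inv : ∀ q ∈ D', ψ q ∈ D
  left_inv : ∀ x ∈ D, ψ (p x, f x) = x
  right_inv : ∀ q ∈ D', p (ψ q) = q.1 ∧ f (ψ q) = q.2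
  smooth : ContMDiffOn (𝓡∂ (2 * n)) (𝓡∂ (2 * n)) ∞ p D
  smooth_inv : ContMDiffOn ((𝓡∂ (2 * n)).prod 𝓘(ℝ, ℂ)) (𝓡∂ (2 * n)) ∞ ψ D'
  boundary : ∀ x ∈ D, p x ∈ (𝓡∂ (2 * n)).boundary M ↔ x ∈ (𝓡∂ (2 * n)).boundary M
  pullback_lam : ∀ x ∈ D, ∀ v : TangentSpace (𝓡∂ (2 * n)) x,
    lam x v = lam (p x) (mfderiv (𝓡∂ (2 * n)) (𝓡∂ (2 * n)) p x v)
      + r * (Complex.I * f x * (starRingEnd ℂ) (dC n f x v)).re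

/-- Triviality of the fibration outside of a compact set, with `M₀ = f⁻¹(z₀)` a regular fibre.

`local_triv`: with `V = M \ K` and `V' = M₀ × ℂ \ K'`, each `z` has a disc `B_δ(z)` and a fibre
preserving diffeomorphism `ψ : V' ∩ (M₀ × B_δ(z)) → V ∩ f⁻¹(B_δ(z))` as in
`IsFibreTrivialization`, the identity over `z₀` if `z₀ ∈ B_δ(z)`, for which the pull-back of `J` is
split, i.e. the product of a complex structure along the fibres and of the standard one on `ℂ`.
Since `f` is `J`-holomorphic, this means that `J` preserves the tangent spaces `ker dp` of
the images of the discs `{x} × B_δ(z)`.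

`boundary_triv`: near `∂M` there is a diffeomorphism from a neighbourhood of `∂M₀ × ℂ` in
`M₀ × ℂ` for which the pull-back of `J` is the product of `J|_{M₀}` and of the standard complex
structure on `ℂ`, i.e. `dp ∘ J = J ∘ dp`. -/
structure TrivialAwayFromCompact
    (lam : (x : M) → TangentSpace (𝓡∂ (2 * n)) x →L[ℝ] ℝ)
    (J : (x : M) → TangentSpace (𝓡∂ (2 * n)) x →L[ℝ] TangentSpace (𝓡∂ (2 * n)) x)
    (f : M → ℂ) (z₀ : ℂ) (K : Set M) (K' : Set (M × ℂ)) (r : ℝ) : Prop where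
  regular : ∀ x, f x = z₀ → x ∉ critSet n f
  r_pos : 0 < r
  compact_K : IsCompact K
  K_subset : K ⊆ ((𝓡∂ (2 * n)).boundary M)ᶜ
  compact_K' : IsCompact K'
  K'_subset : ∀ q ∈ K', f q.1 = z₀ ∧ q.1 ∉ (𝓡∂ (2 * n)).boundary M
  local_triv : ∀ z : ℂ, ∃ δ > 0, ∃ (p : M → M) (ψ : M × ℂ → M),
    IsFibreTrivialization lam f z₀ r (Kᶜ ∩ f ⁻¹' Metric.ball z δ)
      {q | f q.1 = z₀ ∧ q.2 ∈ Metric.ball z δ ∧ q ∉ K'} p ψ ∧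
    (z₀ ∈ Metric.ball z δ → ∀ x, f x = z₀ → (x, z₀) ∉ K' → ψ (x, z₀) = x) ∧
    (∀ x ∈ Kᶜ ∩ f ⁻¹' Metric.ball z δ, ∀ v : TangentSpace (𝓡∂ (2 * n)) x,
      mfderiv (𝓡∂ (2 * n)) (𝓡∂ (2 * n)) p x v = 0 →
        mfderiv (𝓡∂ (2 * n)) (𝓡∂ (2 * n)) p x (J x v) = 0)
  boundary_triv : ∃ (W : Set M) (O' : Set (M × ℂ)) (p : M → M) (ψ : M × ℂ → M),
    IsOpen W ∧ (𝓡∂ (2 * n)).boundary M ⊆ W ∧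
    IsOpen O' ∧ (∀ q : M × ℂ, f q.1 = z₀ → q.1 ∈ (𝓡∂ (2 * n)).boundary M → q ∈ O') ∧
    IsFibreTrivialization lam f z₀ r W {q | f q.1 = z₀ ∧ q ∈ O'} p ψ ∧
    (∀ x ∈ W, ∀ v : TangentSpace (𝓡∂ (2 * n)) x,
      mfderiv (𝓡∂ (2 * n)) (𝓡∂ (2 * n)) p x (J x v)
        = J (p x) (mfderiv (𝓡∂ (2 * n)) (𝓡∂ (2 * n)) p x v))

variable (n) in
/-- The critical values of `f` are in convex position, and the base point `z₀` lies in the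
interior of their convex hull. -/
def ConvexPosition (f : M → ℂ) (z₀ : ℂ) : Prop :=
  (∀ c ∈ f '' critSet n f, c ∉ convexHull ℝ (f '' critSet n f \ {c})) ∧
    z₀ ∈ interior (convexHull ℝ (f '' critSet n f))

/-! ### The perturbation and the equations -/

/-- The function `f` after translating `z₀` to the origin and rotating by the angle `-α`. -/
def normalized (f : M → ℂ) (z₀ : ℂ) (α : ℝ) (x : M) : ℂ :=
  Complex.exp (-(α * Complex.I)) * (f x - z₀)

/-- The special perturbation `θ_ν`, for the angles `θ_- = θm` and `θ_+ = θp` in `(0, π)`.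
(It is monotone on the three transition intervals; the directions are forced by the values
outside of these.) -/
structure IsSpecialPerturbation (θm θp ν : ℝ) (θ : ℝ → ℝ) : Prop where
  smooth : ContDiff ℝ ∞ θ
  outer : ∀ t, ν⁻¹ + 1 ≤ |t| → θ t = 0
  left : ∀ t ∈ Icc (-ν⁻¹) (-ν), θ t = θp
  right : ∀ t ∈ Icc ν ν⁻¹, θ t = θm - Real.pi
  mono_left : MonotoneOn θ (Ioo (-ν⁻¹ - 1) (-ν⁻¹))
  anti_mid : AntitoneOn θ (Ioo (-ν) ν)
  mono_right : MonotoneOn θ (Ioo ν⁻¹ (ν⁻¹ + 1))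
  nonneg : ∀ t ≤ 0, 0 ≤ θ t
  nonpos : ∀ t, 0 ≤ t → θ t ≤ 0

/-- The time dependent vector field `v^t = cos θ(t) v₀ + sin θ(t) v₁` with `v₀ = grad Re f`,
`v₁ = grad Im f`. -/
def perturbationField (lam : (x : M) → TangentSpace (𝓡∂ (2 * n)) x →L[ℝ] ℝ)
    (J : (x : M) → TangentSpace (𝓡∂ (2 * n)) x →L[ℝ] TangentSpace (𝓡∂ (2 * n)) x)
    (f : M → ℂ) (θ : ℝ → ℝ) (t : ℝ) (x : M) : TangentSpace (𝓡∂ (2 * n)) x :=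
  Real.cos (θ t) • grad lam J (fun y => (f y).re) x
    + Real.sin (θ t) • grad lam J (fun y => (f y).im) x

/-- `γ` is a broken flow line: `γ' + v^t(γ) = 0` and `γ(t) → m_∓` as `t → ±∞`. -/
structure IsBrokenFlowLine (lam : (x : M) → TangentSpace (𝓡∂ (2 * n)) x →L[ℝ] ℝ)
    (J : (x : M) → TangentSpace (𝓡∂ (2 * n)) x →L[ℝ] TangentSpace (𝓡∂ (2 * n)) x)
    (f : M → ℂ) (θ : ℝ → ℝ) (mm mp : M) (γ : ℝ → M) : Prop where
  contMDiff : ContMDiff 𝓘(ℝ, ℝ) (𝓡∂ (2 * n)) 1 γ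
  flow : ∀ t : ℝ, mfderiv 𝓘(ℝ, ℝ) (𝓡∂ (2 * n)) γ t (1 : ℝ)
    + perturbationField lam J f θ t (γ t) = 0
  lim_top : Tendsto γ atTop (𝓝 mm)
  lim_bot : Tendsto γ atBot (𝓝 mp)

/-- `u : ℝ²_{s,t} → M` solves the perturbed Floer equation
`∂_s u + J (∂_t u + v^t(u)) = 0`. -/
structure IsFloerSolution (lam : (x : M) → TangentSpace (𝓡∂ (2 * n)) x →L[ℝ] ℝ)
    (J : (x : M) → TangentSpace (𝓡∂ (2 * n)) x →L[ℝ] TangentSpace (𝓡∂ (2 * n)) x)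
    (f : M → ℂ) (θ : ℝ → ℝ) (u : ℝ × ℝ → M) : Prop where
  contMDiff : ContMDiff 𝓘(ℝ, ℝ × ℝ) (𝓡∂ (2 * n)) 1 u
  floer : ∀ s t : ℝ,
    mfderiv 𝓘(ℝ, ℝ × ℝ) (𝓡∂ (2 * n)) u (s, t) ((1, 0) : ℝ × ℝ)
      + J (u (s, t)) (mfderiv 𝓘(ℝ, ℝ × ℝ) (𝓡∂ (2 * n)) u (s, t) ((0, 1) : ℝ × ℝ)
          + perturbationField lam J f θ t (u (s, t))) = 0

/-- The asymptotic conditions `u(s,t) → m_∓` as `t → ±∞`, uniformly in `s`, and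
`u(s,t) → γ_∓(t)` as `s → ±∞`, uniformly in `t`. As `γ_∓` have relatively compact images,
uniform convergence to them with respect to any metric inducing the topology of `M` is the same as
uniform convergence with respect to neighbourhoods of the diagonal of `M × M`. -/
structure HasAsymptotics (mm mp : M) (γm γp : ℝ → M) (u : ℝ × ℝ → M) : Prop where
  t_top : ∀ N ∈ 𝓝 mm, ∀ᶠ t in atTop, ∀ s, u (s, t) ∈ N
  t_bot : ∀ N ∈ 𝓝 mp, ∀ᶠ t in atBot, ∀ s, u (s, t) ∈ N
  s_top : ∀ N ∈ 𝓝ˢ (diagonal M), ∀ᶠ s in atTop, ∀ t, (γm t, u (s, t)) ∈ N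
  s_bot : ∀ N ∈ 𝓝ˢ (diagonal M), ∀ᶠ s in atBot, ∀ t, (γp t, u (s, t)) ∈ N

end LefschetzFloer

end

/-! Two maximum principles confine `u`: one bounds it in the base, the other keeps it away from the
boundary. Both rest on the shape of λ where the fibration is trivial. There λ = p^*λ + r f^*λ_0, so
for X in ker dp the form ω(X, ·) sees only df, and the gradient of Re(a f) is the lift to ker dp of
the constant ā/(2r) (`grad_spec`). Hence the perturbation field is killed by dp and projects under F
= `normalized f z₀ α` to e^{iθ(t)}/(2r) (`perturbationField_spec`).

In the base: off `K`, F(u) solves a Cauchy-Riemann equation whose inhomogeneity depends on t alone.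
As θ has compact support, a bounded shift b(t) makes this inhomogeneity constant, and the norm of a
solution then obeys the strong maximum principle. This gives ‖F(u)‖ ≤ R
(`exists_norm_normalized_le`), a compact region since `f` is proper.

At the boundary: p is holomorphic and kills the field, so p ∘ u is J-holomorphic and h ∘ p ∘ u is
subharmonic, while h ∘ p vanishes exactly on ∂M.

Since the plane is not compact, a strong maximum principle rules out every compact nonempty
superlevel set (`forall_lt_of_isCompact`). Compactness comes from the asymptotics: for t → ±∞ the
limits are critical points, and for s → ±∞ they are flow lines, which are s-independent Floer
solutions and are treated first by the same principle. -/

noncomputable section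

namespace LefschetzFloer

variable {n : ℕ} [NeZero n] {M : Type*} [TopologicalSpace M]
  [ChartedSpace (EuclideanHalfSpace (2 * n)) M]

/-! ### The symplectic form in a trivialization -/

/-- The antisymmetrized derivative of `μ(P)∘P' + r Re (i φ dφ̄)`, evaluated at a vector in the
kernel of `P'`. -/
theorem fderivWithin_pullback_antisymm {E F : Type*} [NormedAddCommGroup E] [NormedSpace ℝ E]
    [NormedAddCommGroup F] [NormedSpace ℝ F] {s : Set E} {y : E} {t : Set F}
    (hs : UniqueDiffOn ℝ s) (hy : y ∈ s) (hy' : y ∈ closure (interior s))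
    {η : E → E →L[ℝ] ℝ} {μ : F → F →L[ℝ] ℝ} {P : E → F} {φ : E → ℂ} {r : ℝ}
    (hη : DifferentiableWithinAt ℝ η s y) (hμ : DifferentiableWithinAt ℝ μ t (P y))
    (hP : ContDiffWithinAt ℝ 2 P s y) (hPt : Tendsto P (𝓝[s] y) (𝓝[t] (P y)))
    (hφ : ContDiffWithinAt ℝ 2 φ s y)
    (heq : ∀ᶠ z in 𝓝[s] y, ∀ v, η z v = μ (P z) (fderivWithin ℝ P s z v)
      + r * (Complex.I * φ z * (starRingEnd ℂ) (fderivWithin ℝ φ s z v)).re)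
    {X : E} (hX : fderivWithin ℝ P s y X = 0) (Y : E) :
    fderivWithin ℝ η s y X Y - fderivWithin ℝ η s y Y X
      = -2 * r * (fderivWithin ℝ φ s y X * (starRingEnd ℂ) (fderivWithin ℝ φ s y Y)).im := by
  have hP1 : DifferentiableWithinAt ℝ P s y := hP.differentiableWithinAt (by norm_num)
  have hφ1 : DifferentiableWithinAt ℝ φ s y := hφ.differentiableWithinAt (by norm_num)
  have hP2 : DifferentiableWithinAt ℝ (fderivWithin ℝ P s) s y :=
    (hP.fderivWithin_right (m := 1) hs (by norm_num) hy).differentiableWithinAt (by norm_num)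
  have hφ2 : DifferentiableWithinAt ℝ (fderivWithin ℝ φ s) s y :=
    (hφ.fderivWithin_right (m := 1) hs (by norm_num) hy).differentiableWithinAt (by norm_num)
  have symP := hP.isSymmSndFDerivWithinAt (by simp) hs hy' hy
  have symφ := hφ.isSymmSndFDerivWithinAt (by simp) hs hy' hy
  have hμP : HasFDerivWithinAt (fun z => μ (P z))
      ((fderivWithin ℝ μ t (P y)).comp (fderivWithin ℝ P s y)) s y :=
    hμ.hasFDerivWithinAt.comp_of_tendsto y hP1.hasFDerivWithinAt hPt
  have key : ∀ A B : E, fderivWithin ℝ η s y A B =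
      fderivWithin ℝ μ t (P y) (fderivWithin ℝ P s y A) (fderivWithin ℝ P s y B)
      + μ (P y) (fderivWithin ℝ (fderivWithin ℝ P s) s y A B)
      + r * (Complex.I * fderivWithin ℝ φ s y A * (starRingEnd ℂ) (fderivWithin ℝ φ s y B)
        + Complex.I * φ y
          * (starRingEnd ℂ) (fderivWithin ℝ (fderivWithin ℝ φ s) s y A B)).re := by
    intro A B
    have h1 : HasFDerivWithinAt (fun z => η z B) _ s y :=
      hη.hasFDerivWithinAt.clm_apply (hasFDerivWithinAt_const B y s)
    have h2 := hμP.clm_apply (hP2.hasFDerivWithinAt.clm_apply (hasFDerivWithinAt_const B y s))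
    have h3 := Complex.conjCLE.toContinuousLinearMap.hasFDerivAt.comp_hasFDerivWithinAt y
      (hφ2.hasFDerivWithinAt.clm_apply (hasFDerivWithinAt_const B y s))
    have h4 := (Complex.reCLM.hasFDerivAt.comp_hasFDerivWithinAt y
      ((hφ1.hasFDerivWithinAt.const_mul Complex.I).mul h3)).const_mul r
    have h5 := (h2.add h4).congr_of_eventuallyEq (f₁ := fun z => η z B)
      (by filter_upwards [heq] with z hz using by simpa using hz B)
      (by simpa using heq.self_of_nhdsWithin hy B)
    have h6 := DFunLike.congr_fun ((hs y hy).eq h1 h5) A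
    simp at h6
    rw [h6]
    simp
    ring
  -- The terms with μ' contain P'X = 0, and those with second derivatives cancel by symmetry; only
  -- the derivative of the factor φ in i φ dφ̄ survives.
  rw [key X Y, key Y X, hX, symP X Y, symφ X Y]
  simp
  ring

section

variable [IsManifold (𝓡∂ (2 * n)) ∞ M]

/-- The inverse of the tangent trivialization at `x` is the derivative of the inverse chart, so on
the chart target the coordinates of the section `lam` are exactly `oneFormInChart`. -/
theorem SmoothOneForm.differentiableWithinAt_oneFormInChart
    {lam : (x : M) → TangentSpace (𝓡∂ (2 * n)) x →L[ℝ] ℝ} (hlam : SmoothOneForm lam) (x : M) :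
    DifferentiableWithinAt ℝ (oneFormInChart lam x) (range (𝓡∂ (2 * n)))
      (extChartAt (𝓡∂ (2 * n)) x x) := by
  have h := (contMDiffAt_hom_bundle (E₂ := Bundle.Trivial M ℝ) _).1 (hlam x)
  have h2 := (mdifferentiableAt_iff _ _).1 (h.2.mdifferentiableAt (by simp)) |>.2
  refine h2.congr_of_eventuallyEq_of_mem ?_ (mem_range_self _)
  filter_upwards [extChartAt_target_mem_nhdsWithin (I := 𝓡∂ (2 * n)) x] with y hy
  have hmem : (extChartAt (𝓡∂ (2 * n)) x).symm y
      ∈ (chartAt (EuclideanHalfSpace (2 * n)) x).source := by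
    simpa using (extChartAt (𝓡∂ (2 * n)) x).map_target hy
  have h3 := TangentBundle.symmL_trivializationAt (I := 𝓡∂ (2 * n)) hmem
  rw [(extChartAt (𝓡∂ (2 * n)) x).right_inv hy] at h3
  simp only [oneFormInChart, writtenInExtChartAt, extChartAt_model_space_eq_id, Function.comp,
    PartialEquiv.refl_coe, id, ContinuousLinearMap.inCoordinates]
  rw [← h3]
  ext v
  simp

/-- The symplectic form on the kernel of the differential of `p`, when
`λ = p^* λ + r f^* λ_0` near `x`. -/
theorem omega_eq_of_pullback {lam : (x : M) → TangentSpace (𝓡∂ (2 * n)) x →L[ℝ] ℝ}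
    (hlam : SmoothOneForm lam) {f : M → ℂ} (hf : ContMDiff (𝓡∂ (2 * n)) 𝓘(ℝ, ℂ) ∞ f)
    {D : Set M} (hD : IsOpen D) {p : M → M}
    (hp : ContMDiffOn (𝓡∂ (2 * n)) (𝓡∂ (2 * n)) ∞ p D) {r : ℝ}
    (hpull : ∀ x ∈ D, ∀ v : TangentSpace (𝓡∂ (2 * n)) x,
      lam x v = lam (p x) (mfderiv (𝓡∂ (2 * n)) (𝓡∂ (2 * n)) p x v)
        + r * (Complex.I * f x * (starRingEnd ℂ) (dC n f x v)).re)
    {x : M} (hx : x ∈ D) {X : TangentSpace (𝓡∂ (2 * n)) x}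
    (hX : mfderiv (𝓡∂ (2 * n)) (𝓡∂ (2 * n)) p x X = 0) (Y : TangentSpace (𝓡∂ (2 * n)) x) :
    omega lam x X Y = -2 * r * (dC n f x X * (starRingEnd ℂ) (dC n f x Y)).im := by
  have hpx : ContMDiffAt (𝓡∂ (2 * n)) (𝓡∂ (2 * n)) ∞ p x := hp.contMDiffAt (hD.mem_nhds hx)
  have hpd := hpx.mdifferentiableAt (by simp)
  have hfd := (hf x).mdifferentiableAt (by simp)
  have hdf : dC n f x = fderivWithin ℝ
      (writtenInExtChartAt (𝓡∂ (2 * n)) 𝓘(ℝ, ℂ) x f) (range (𝓡∂ (2 * n)))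
      (extChartAt (𝓡∂ (2 * n)) x x) := hfd.mfderiv
  have hpc := (contMDiffAt_iff.1 hpx).2
  have hfc := (contMDiffAt_iff.1 (hf x)).2
  rw [hpd.mfderiv] at hX
  rw [hdf]
  have hy : extChartAt (𝓡∂ (2 * n)) x x ∈ range (𝓡∂ (2 * n)) := mem_range_self _
  refine fderivWithin_pullback_antisymm (t := range (𝓡∂ (2 * n)))
    (μ := oneFormInChart lam (p x)) (𝓡∂ (2 * n)).uniqueDiffOn hy
    ((𝓡∂ (2 * n)).range_subset_closure_interior hy)
    (hlam.differentiableWithinAt_oneFormInChart x) ?_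
    (P := writtenInExtChartAt (𝓡∂ (2 * n)) (𝓡∂ (2 * n)) x p)
    (φ := writtenInExtChartAt (𝓡∂ (2 * n)) 𝓘(ℝ, ℂ) x f)
    (hpc.of_le (WithTop.coe_le_coe.2 le_top)) ?_
    (hfc.of_le (WithTop.coe_le_coe.2 le_top)) ?_ hX Y
  · have h := hlam.differentiableWithinAt_oneFormInChart (p x)
    rwa [show extChartAt (𝓡∂ (2 * n)) (p x) (p x) = writtenInExtChartAt (𝓡∂ (2 * n))
      (𝓡∂ (2 * n)) x p (extChartAt (𝓡∂ (2 * n)) x x) by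
        rw [writtenInExtChartAt, Function.comp, Function.comp, extChartAt_to_inv]] at h
  · refine tendsto_nhdsWithin_iff.2 ⟨hpc.continuousWithinAt, Eventually.of_forall fun z => ?_⟩
    exact mem_range_self _
  have hcont : Tendsto (extChartAt (𝓡∂ (2 * n)) x).symm
      (𝓝[range (𝓡∂ (2 * n))] (extChartAt (𝓡∂ (2 * n)) x x)) (𝓝 x) := by
    have h := (continuousAt_extChartAt_symm (I := 𝓡∂ (2 * n)) x).tendsto
    rw [extChartAt_to_inv] at h
    exact h.mono_left nhdsWithin_le_nhds
  have hps : {x' | x' ∈ D ∧ p x' ∈ (extChartAt (𝓡∂ (2 * n)) (p x)).source} ∈ 𝓝 x :=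
    inter_mem (hD.mem_nhds hx) (hpx.continuousAt (extChartAt_source_mem_nhds (p x)))
  filter_upwards [self_mem_nhdsWithin, extChartAt_target_mem_nhdsWithin (I := 𝓡∂ (2 * n)) x,
    hcont hps, eventually_eventually_nhdsWithin.2 (hcont hps)] with z hzr hzt hzD hzE v
  have hU : UniqueMDiffWithinAt 𝓘(ℝ, EuclideanSpace ℝ (Fin (2 * n))) (range (𝓡∂ (2 * n))) z :=
    ((𝓡∂ (2 * n)).uniqueDiffOn z hzr).uniqueMDiffWithinAt
  have hφ := (mdifferentiableWithinAt_extChartAt_symm hzt).hasMFDerivWithinAt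
  have hpz : MDifferentiableAt (𝓡∂ (2 * n)) (𝓡∂ (2 * n)) p ((extChartAt (𝓡∂ (2 * n)) x).symm z) :=
    (hp.contMDiffAt (hD.mem_nhds hzD.1)).mdifferentiableAt (by simp)
  have hfz : MDifferentiableAt (𝓡∂ (2 * n)) 𝓘(ℝ, ℂ) f ((extChartAt (𝓡∂ (2 * n)) x).symm z) :=
    (hf _).mdifferentiableAt (by simp)
  have hpφ := hpz.hasMFDerivAt.comp_hasMFDerivWithinAt z hφ
  have hfφ := hfz.hasMFDerivAt.comp_hasMFDerivWithinAt z hφ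
  have hfφ' : fderivWithin ℝ (writtenInExtChartAt (𝓡∂ (2 * n)) 𝓘(ℝ, ℂ) x f)
      (range (𝓡∂ (2 * n))) z = _ := mfderivWithin_eq_fderivWithin.symm.trans (hfφ.mfderivWithin hU)
  have hψ : HasMFDerivAt (𝓡∂ (2 * n)) 𝓘(ℝ, EuclideanSpace ℝ (Fin (2 * n)))
    (extChartAt (𝓡∂ (2 * n)) (p x)) (p ((extChartAt (𝓡∂ (2 * n)) x).symm z)) _ :=
    (mdifferentiableAt_extChartAt (by simpa using hzD.2)).hasMFDerivAt
  have hP := hψ.comp_hasMFDerivWithinAt z hpφ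
  have hPd : DifferentiableWithinAt ℝ (writtenInExtChartAt (𝓡∂ (2 * n)) (𝓡∂ (2 * n)) x p)
    (range (𝓡∂ (2 * n))) z := hP.mdifferentiableWithinAt.differentiableWithinAt
  have hP' := hPd.hasFDerivWithinAt.hasMFDerivWithinAt
  have hψs := (mdifferentiableWithinAt_extChartAt_symm (I := 𝓡∂ (2 * n))
    ((extChartAt (𝓡∂ (2 * n)) (p x)).map_source hzD.2)).hasMFDerivWithinAt
  -- Near z the inverse chart at `p x`, composed with p in coordinates, is p after the inverse chart
  -- at `x`; comparing derivatives identifies the pull-back of the coordinate form with that of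
  -- `lam`.
  have hcomp := HasMFDerivWithinAt.comp z hψs hP' (fun _ _ => mem_range_self _)
  have hcomp' := hcomp.congr_of_eventuallyEq (f₁ := p ∘ (extChartAt (𝓡∂ (2 * n)) x).symm)
    (by filter_upwards [hzE] with z' hz' using
          ((extChartAt (𝓡∂ (2 * n)) (p x)).left_inv hz'.2).symm)
    ((extChartAt (𝓡∂ (2 * n)) (p x)).left_inv hzD.2).symm
  have huniq := DFunLike.congr_fun (hU.eq hpφ hcomp') v
  -- The two base points are equal only propositionally; their tangent spaces are both the model
  -- space, so `lam` can be carried from one to the other.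
  have hpt : ∀ q : M, q = p ((extChartAt (𝓡∂ (2 * n)) x).symm z) →
      ∀ a : EuclideanSpace ℝ (Fin (2 * n)),
      lam q a = lam (p ((extChartAt (𝓡∂ (2 * n)) x).symm z)) a := by rintro _ rfl _; rfl
  refine (hpull _ hzD.1 _).trans ?_
  rw [hfφ']
  refine congrArg₂ (· + ·) ?_ rfl
  refine (congrArg _ huniq).trans ?_
  exact (hpt _ ((extChartAt (𝓡∂ (2 * n)) (p x)).left_inv hzD.2) _).symm

end

/-! ### The gradient in a trivialization -/

theorem omega_sub_left (lam : (x : M) → TangentSpace (𝓡∂ (2 * n)) x →L[ℝ] ℝ) (x : M)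
    (v v' w : TangentSpace (𝓡∂ (2 * n)) x) :
    omega lam x (v - v') w = omega lam x v w - omega lam x v' w := by
  have h1 := congrArg (fun L => L w) ((fderivWithin ℝ (oneFormInChart lam x) (range (𝓡∂ (2 * n)))
      (extChartAt (𝓡∂ (2 * n)) x x)).map_sub v v')
  have h2 := (fderivWithin ℝ (oneFormInChart lam x) (range (𝓡∂ (2 * n)))
      (extChartAt (𝓡∂ (2 * n)) x x) w).map_sub v v'
  simp only [omega]
  refine (congrArg₂ (· - ·) h1 h2).trans ?_
  exact sub_sub_sub_comm _ _ _ _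

section

variable {lam : (x : M) → TangentSpace (𝓡∂ (2 * n)) x →L[ℝ] ℝ}
  {J : (x : M) → TangentSpace (𝓡∂ (2 * n)) x →L[ℝ] TangentSpace (𝓡∂ (2 * n)) x}
  {f : M → ℂ} {z₀ : ℂ} {r : ℝ} {D : Set M} {D' : Set (M × ℂ)} {p : M → M} {ψ : M × ℂ → M}

/-- Horizontal lift of a tangent vector of the base. -/
theorem IsFibreTrivialization.exists_lift
    (hT : IsFibreTrivialization lam f z₀ r D D' p ψ) (hD : IsOpen D)
    (hf : ContMDiff (𝓡∂ (2 * n)) 𝓘(ℝ, ℂ) ∞ f) {x : M} (hx : x ∈ D) (c : ℂ)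
    (hc : ∀ᶠ τ : ℝ in 𝓝 0, (p x, f x + τ * c) ∈ D') :
    ∃ X : TangentSpace (𝓡∂ (2 * n)) x,
      mfderiv (𝓡∂ (2 * n)) (𝓡∂ (2 * n)) p x X = 0 ∧ dC n f x X = c := by
  obtain ⟨σ, hσ0, hσ, hpσ, hfσ⟩ : ∃ σ : ℝ → M, σ 0 = x ∧
      MDifferentiableAt 𝓘(ℝ, ℝ) (𝓡∂ (2 * n)) σ 0 ∧ (p ∘ σ =ᶠ[𝓝 0] fun _ => p x) ∧
      (f ∘ σ =ᶠ[𝓝 0] fun τ : ℝ => f x + τ * c) := by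
    -- The lift is the velocity of this curve. `D'` need not be open in M × ℂ, so ψ is
    -- differentiated only along a line that stays in `D'` for small τ.
    refine ⟨fun τ => ψ (p x, f x + τ * c), by simpa using hT.left_inv x hx, ?_, ?_, ?_⟩
    · have h1 : ContMDiff 𝓘(ℝ, ℝ) ((𝓡∂ (2 * n)).prod 𝓘(ℝ, ℂ)) ∞
          (fun τ : ℝ => (p x, f x + τ * c)) := by
        refine contMDiff_const.prodMk (ContDiff.contMDiff ?_)
        exact contDiff_const.add (Complex.ofRealCLM.contDiff.mul contDiff_const)
      have h2 := (hT.smooth_inv _ hc.self_of_nhds).comp (0 : ℝ)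
        (h1.contMDiffAt.contMDiffWithinAt (s := {τ : ℝ | (p x, f x + τ * c) ∈ D'}))
        (fun _ h => h)
      exact (h2.contMDiffAt hc).mdifferentiableAt (by simp)
    · filter_upwards [hc] with τ hτ using (hT.right_inv _ hτ).1
    · filter_upwards [hc] with τ hτ using (hT.right_inv _ hτ).2
  subst hσ0
  have hpd : MDifferentiableAt (𝓡∂ (2 * n)) (𝓡∂ (2 * n)) p (σ 0) :=
    (hT.smooth.contMDiffAt (hD.mem_nhds hx)).mdifferentiableAt (by simp)
  have hfd : MDifferentiableAt (𝓡∂ (2 * n)) 𝓘(ℝ, ℂ) f (σ 0) := (hf _).mdifferentiableAt (by simp)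
  have h1 := (hasMFDerivAt_const (I := 𝓘(ℝ, ℝ)) (I' := 𝓡∂ (2 * n)) (p (σ 0))
    (0 : ℝ)).congr_of_eventuallyEq hpσ
  have h2 : HasMFDerivAt 𝓘(ℝ, ℝ) 𝓘(ℝ, ℂ) (fun τ : ℝ => f (σ 0) + τ * c) 0
      ((ContinuousLinearMap.id ℝ ℝ).smulRight c : ℝ →L[ℝ] ℂ) := by
    refine HasFDerivAt.hasMFDerivAt ?_
    have := (((ContinuousLinearMap.id ℝ ℝ).smulRight c).hasFDerivAt (x := 0)).const_add (f (σ 0))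
    exact this
  have h2' := h2.congr_of_eventuallyEq hfσ
  refine ⟨mfderiv 𝓘(ℝ, ℝ) (𝓡∂ (2 * n)) σ 0 (1 : ℝ), ?_, ?_⟩
  · exact DFunLike.congr_fun (hasMFDerivAt_unique (hpd.hasMFDerivAt.comp 0 hσ.hasMFDerivAt) h1)
      (1 : ℝ)
  · have := DFunLike.congr_fun
      (hasMFDerivAt_unique (hfd.hasMFDerivAt.comp 0 hσ.hasMFDerivAt) h2') (1 : ℝ)
    exact this.trans (one_smul ℝ c)

variable [IsManifold (𝓡∂ (2 * n)) ∞ M]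

/-- `grad` is a choice: the candidate `v` shows that the choice satisfies its defining property, and
definiteness of the metric leaves only one such vector. -/
theorem IsExactAlmostKahler.grad_eq (hM : IsExactAlmostKahler lam J) {φ : M → ℝ} {x : M}
    {v : TangentSpace (𝓡∂ (2 * n)) x}
    (hv : ∀ w, metric lam J x v w = mfderiv (𝓡∂ (2 * n)) 𝓘(ℝ, ℝ) φ x w) :
    grad lam J φ x = v := by
  have hg : ∀ w, metric lam J x (grad lam J φ x) w = mfderiv (𝓡∂ (2 * n)) 𝓘(ℝ, ℝ) φ x w :=
    Classical.epsilon_spec (p := fun v : TangentSpace (𝓡∂ (2 * n)) x =>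
      ∀ w, metric lam J x v w = mfderiv (𝓡∂ (2 * n)) 𝓘(ℝ, ℝ) φ x w) ⟨v, hv⟩
  by_contra hne
  have h := hM.metric_pos x (grad lam J φ x - v) (sub_ne_zero.2 hne)
  have h2 : metric lam J x (grad lam J φ x - v) (grad lam J φ x - v) = 0 := by
    rw [metric, omega_sub_left]
    exact sub_eq_zero.2 ((hg _).trans (hv _).symm)
  exact h.ne' h2

/-- The lift X of ā/(2r) satisfies ω(X, Jw) = -2r Im((ā/2r) · conj(i df(w))) = Re(a df(w)), which is
the defining property of the gradient. -/
theorem IsFibreTrivialization.grad_spec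
    (hT : IsFibreTrivialization lam f z₀ r D D' p ψ) (hD : IsOpen D) (hr : 0 < r)
    (hM : IsExactAlmostKahler lam J) (hf : IsHolomorphicFunction J f) {x : M} (hx : x ∈ D)
    (hc : ∀ c : ℂ, ∀ᶠ τ : ℝ in 𝓝 0, (p x, f x + τ * c) ∈ D') {φ : M → ℝ} {a : ℂ}
    (hφ : ∀ w, mfderiv (𝓡∂ (2 * n)) 𝓘(ℝ, ℝ) φ x w = (a * dC n f x w).re) :
    mfderiv (𝓡∂ (2 * n)) (𝓡∂ (2 * n)) p x (grad lam J φ x) = 0 ∧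
      dC n f x (grad lam J φ x) = (starRingEnd ℂ) a / (2 * r) := by
  obtain ⟨X, hX, hX'⟩ := hT.exists_lift hD hf.smooth hx ((starRingEnd ℂ) a / (2 * r)) (hc _)
  have h : grad lam J φ x = X := by
    refine hM.grad_eq fun w => ?_
    rw [metric, omega_eq_of_pullback hM.smooth_lam hf.smooth hD hT.smooth hT.pullback_lam hx hX,
      hX', hf.holomorphic, hφ w]
    have h2 : (starRingEnd ℂ) a / (2 * r) = (((2 * r)⁻¹ : ℝ) : ℂ) * (starRingEnd ℂ) a := by
      push_cast; rw [div_eq_inv_mul]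
    rw [h2]
    generalize dC n f x w = b
    simp [Complex.mul_re, Complex.mul_im]
    field_simp
    ring
  rw [h]
  exact ⟨hX, hX'⟩

/-- Where the fibration is trivial, the perturbation field is the horizontal lift of a constant
vector field. -/
theorem IsFibreTrivialization.perturbationField_spec
    (hT : IsFibreTrivialization lam f z₀ r D D' p ψ) (hD : IsOpen D) (hr : 0 < r)
    (hM : IsExactAlmostKahler lam J) (hf : IsHolomorphicFunction J f) {x : M} (hx : x ∈ D)
    (hc : ∀ c : ℂ, ∀ᶠ τ : ℝ in 𝓝 0, (p x, f x + τ * c) ∈ D') (α : ℝ) (θ : ℝ → ℝ) (t : ℝ) :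
    mfderiv (𝓡∂ (2 * n)) (𝓡∂ (2 * n)) p x
        (perturbationField lam J (normalized f z₀ α) θ t x) = 0 ∧
      Complex.exp (-(α * Complex.I)) * dC n f x
        (perturbationField lam J (normalized f z₀ α) θ t x)
        = Complex.exp (θ t * Complex.I) / (2 * r) := by
  set e := Complex.exp (-(α * Complex.I)) with he
  have hfd : HasMFDerivAt (𝓡∂ (2 * n)) 𝓘(ℝ, ℂ) f x (dC n f x) :=
    ((hf.smooth x).mdifferentiableAt (by simp)).hasMFDerivAt
  have hre : ∀ w, mfderiv (𝓡∂ (2 * n)) 𝓘(ℝ, ℝ) (fun y => (normalized f z₀ α y).re) x w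
      = (e * dC n f x w).re := by
    have h1 : HasFDerivAt (fun z : ℂ => (e * (z - z₀)).re)
        (Complex.reCLM.comp (e • ContinuousLinearMap.id ℝ ℂ)) (f x) :=
      Complex.reCLM.hasFDerivAt.comp (f x) (((hasFDerivAt_id (f x)).sub_const z₀).const_mul e)
    intro w
    have h2 : mfderiv (𝓡∂ (2 * n)) 𝓘(ℝ, ℝ) (fun y => (normalized f z₀ α y).re) x = _ :=
      (h1.hasMFDerivAt.comp x hfd).mfderiv
    rw [h2]
    rfl
  -- As Im w = Re(-i w), the imaginary part falls under `grad_spec` with a = -ie; the two gradients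
  -- then project to ē/(2r) and iē/(2r).
  have him : ∀ w, mfderiv (𝓡∂ (2 * n)) 𝓘(ℝ, ℝ) (fun y => (normalized f z₀ α y).im) x w
      = (-Complex.I * e * dC n f x w).re := by
    have h1 : HasFDerivAt (fun z : ℂ => (e * (z - z₀)).im)
        (Complex.imCLM.comp (e • ContinuousLinearMap.id ℝ ℂ)) (f x) :=
      Complex.imCLM.hasFDerivAt.comp (f x) (((hasFDerivAt_id (f x)).sub_const z₀).const_mul e)
    intro w
    have h2 : mfderiv (𝓡∂ (2 * n)) 𝓘(ℝ, ℝ) (fun y => (normalized f z₀ α y).im) x = _ :=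
      (h1.hasMFDerivAt.comp x hfd).mfderiv
    rw [h2, mul_assoc, neg_mul, Complex.neg_re, Complex.I_mul_re, neg_neg]
    rfl
  obtain ⟨h1, h1'⟩ := hT.grad_spec hD hr hM hf hx hc hre
  obtain ⟨h2, h2'⟩ := hT.grad_spec hD hr hM hf hx hc him
  have hee : e * (starRingEnd ℂ) e = 1 := by
    rw [Complex.mul_conj, Complex.normSq_eq_norm_sq, he,
      show -(α * Complex.I) = ((-α : ℝ) : ℂ) * Complex.I by push_cast; ring,
      Complex.norm_exp_ofReal_mul_I]
    simp
  constructor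
  · rw [perturbationField, map_add, map_smul, map_smul, h1, h2]
    simp
  · rw [perturbationField, map_add, map_smul, map_smul, h1', h2', Complex.exp_mul_I,
      ← Complex.ofReal_cos, ← Complex.ofReal_sin]
    simp only [Complex.real_smul, map_mul, map_neg, Complex.conj_I, neg_neg]
    linear_combination ((Real.cos (θ t) + Real.sin (θ t) * Complex.I) / (2 * r)) * hee

end
/-! ### Maximum principles -/

/-- If the superlevel set were nonempty, φ would attain its maximum on it. The set of maximum points
is closed, and open by `hloc`, so it would be all of X, making X compact. -/
theorem forall_lt_of_isCompact {X : Type*} [TopologicalSpace X] [T2Space X] [PreconnectedSpace X]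
    [NoncompactSpace X] {G : Set X} (hG : IsOpen G) {φ : X → ℝ} (hφ : ContinuousOn φ G)
    (hloc : ∀ z ∈ G, IsLocalMax φ z → ∀ᶠ z' in 𝓝 z, φ z' = φ z) {a : ℝ}
    (hc : IsCompact {z | z ∈ G ∧ a ≤ φ z}) : ∀ z ∈ G, φ z < a := by
  by_contra! hcon
  obtain ⟨z₁, hz₁, ha⟩ := hcon
  have hsub : {z | z ∈ G ∧ a ≤ φ z} ⊆ G := fun z hz => hz.1
  obtain ⟨z, hz, hmax⟩ := hc.exists_isMaxOn ⟨z₁, hz₁, ha⟩ (hφ.mono hsub)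
  have hclosed : IsClosed ({z | z ∈ G ∧ a ≤ φ z} ∩ φ ⁻¹' {φ z}) :=
    (hφ.mono hsub).preimage_isClosed_of_isClosed hc.isClosed isClosed_singleton
  have hopen : IsOpen ({z | z ∈ G ∧ a ≤ φ z} ∩ φ ⁻¹' {φ z}) := by
    refine isOpen_iff_mem_nhds.2 fun y hy => ?_
    have hyG : y ∈ G := hy.1.1
    have hyz : φ y = φ z := hy.2
    have hlm : IsLocalMax φ y := by
      filter_upwards [hG.mem_nhds hyG] with y' hy'
      rw [hyz]
      by_cases h : a ≤ φ y'
      · exact hmax ⟨hy', h⟩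
      · exact (not_le.1 h).le.trans hz.2
    filter_upwards [hG.mem_nhds hyG, hloc y hyG hlm] with y' h1 h2
    exact ⟨⟨h1, by rw [h2]; exact hy.1.2⟩, h2.trans hyz⟩
  have huniv := IsClopen.eq_univ ⟨hclosed, hopen⟩ ⟨z, hz, rfl⟩
  refine noncompact_univ X ?_
  rw [← huniv]
  exact hc.of_isClosed_subset hclosed inter_subset_left

/-- The norm of a solution of `∂_t q = i ∂_s q - c` obeys the strong maximum principle. -/
theorem eventually_norm_eq_of_isLocalMax {G : Set ℂ} (hG : IsOpen G) {q : ℂ → ℂ} {c : ℝ}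
    (hq : ∀ z ∈ G, DifferentiableAt ℝ q z)
    (hcr : ∀ z ∈ G, fderiv ℝ q z Complex.I = Complex.I * fderiv ℝ q z 1 - c)
    {z : ℂ} (hz : z ∈ G) (hmax : IsLocalMax (fun z => ‖q z‖) z) :
    ∀ᶠ z' in 𝓝 z, ‖q z'‖ = ‖q z‖ := by
  set A := q z with hA
  have hhol : ∀ y ∈ G, DifferentiableAt ℂ (fun z => q z + c * z.im) y := by
    intro y hy
    have him : HasFDerivAt (fun z : ℂ => (c : ℂ) * (z.im : ℂ))
        ((c : ℂ) • Complex.ofRealCLM.comp Complex.imCLM) y :=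
      ((Complex.ofRealCLM.comp Complex.imCLM).hasFDerivAt).const_mul (c : ℂ)
    have hsum := (hq y hy).hasFDerivAt.add him
    refine differentiableAt_complex_iff_differentiableAt_real.2 ⟨hsum.differentiableAt, ?_⟩
    have hfd : fderiv ℝ (fun z => q z + c * z.im) y = _ := hsum.fderiv
    rw [hfd]
    simp [hcr y hy]
  -- The function q + c Im z is holomorphic; the last term restores the real part, so Re k = Re(Ā q)
  -- ≤ |A||q|, with equality at z. Hence |exp k| has a local maximum there, and the maximum modulus
  -- principle makes exp k locally constant.
  set k : ℂ → ℂ := fun z' => (starRingEnd ℂ) A * (q z' + c * z'.im) + Complex.I * (c * A.re) * z'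
    with hk
  have hkre : ∀ z', (k z').re = ((starRingEnd ℂ) A * q z').re := by
    intro z'
    simp [hk]
    ring
  have hle : ∀ z', ((starRingEnd ℂ) A * q z').re ≤ ‖A‖ * ‖q z'‖ := fun z' =>
    (Complex.re_le_norm _).trans (by simp)
  have hself : ((starRingEnd ℂ) A * q z).re = ‖A‖ * ‖A‖ := by
    rw [← hA, mul_comm, Complex.mul_conj, Complex.normSq_eq_norm_sq, Complex.ofReal_re, sq]
  have hev := Complex.eventually_eq_of_isLocalMax_norm (f := fun z => Complex.exp (k z)) (c := z)
    (by
      filter_upwards [hG.mem_nhds hz] with y hy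
      exact (((hhol y hy).const_mul _).add (differentiableAt_id.const_mul _)).cexp)
    (by
      filter_upwards [hmax] with y hy
      simp only [Function.comp, Complex.norm_exp, hkre]
      rw [hself]
      exact Real.exp_le_exp.2 ((hle y).trans (mul_le_mul_of_nonneg_left hy (norm_nonneg _))))
  filter_upwards [hev, hmax] with y hy hy2
  have h1 := congrArg norm hy
  simp only [Complex.norm_exp, hkre] at h1
  have h2 := Real.exp_injective h1
  rw [hself] at h2
  have h3 := hle y
  rw [h2] at h3
  refine le_antisymm hy2 ?_
  rcases (norm_nonneg A).eq_or_lt with h0 | h0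
  · rw [← h0]; exact norm_nonneg _
  · exact le_of_mul_le_mul_left h3 h0

/-- The strong maximum principle for continuous functions with the sub-mean value property. -/
theorem eventually_eq_of_isLocalMax_of_le_circleAverage {G : Set ℂ} (hG : IsOpen G) {φ : ℂ → ℝ}
    (hφ : ContinuousOn φ G)
    (hsub : ∀ z R, 0 < R → Metric.closedBall z R ⊆ G → φ z ≤ Real.circleAverage φ z R)
    {z : ℂ} (hz : z ∈ G) (hmax : IsLocalMax φ z) : ∀ᶠ z' in 𝓝 z, φ z' = φ z := by
  obtain ⟨ε, hε, hball⟩ := Metric.mem_nhds_iff.1 (inter_mem (hG.mem_nhds hz) hmax)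
  filter_upwards [Metric.ball_mem_nhds z hε] with y hy
  rcases eq_or_ne y z with rfl | hne
  · rfl
  by_contra hlt
  have hlt : φ y < φ z := lt_of_le_of_ne (hball hy).2 hlt
  have hR : 0 < dist y z := dist_pos.2 hne
  have hcb : Metric.closedBall z (dist y z) ⊆ Metric.ball z ε :=
    Metric.closedBall_subset_ball hy
  have hmem : ∀ s, circleMap z (dist y z) s ∈ Metric.ball z ε := fun s =>
    hcb (Metric.sphere_subset_closedBall (circleMap_mem_sphere z hR.le s))
  have havg := hsub z _ hR (hcb.trans fun x hx => (hball hx).1)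
  obtain ⟨s, hs, hsy⟩ : y ∈ circleMap z (dist y z) '' Ioc 0 (2 * Real.pi) := by
    rw [image_circleMap_Ioc, abs_of_pos hR]
    exact Metric.mem_sphere.2 rfl
  -- On the circle about z through y, φ is at most φ z, and strictly less at y, so its average is
  -- strictly below φ z.
  have hint : ∫ s in (0 : ℝ)..(2 * Real.pi), φ (circleMap z (dist y z) s)
      < ∫ _ in (0 : ℝ)..(2 * Real.pi), φ z :=
    intervalIntegral.integral_lt_integral_of_continuousOn_of_le_of_exists_lt Real.two_pi_pos
      (hφ.comp (continuous_circleMap _ _).continuousOn fun s _ => (hball (hmem s)).1)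
      continuousOn_const (fun s _ => (hball (hmem s)).2) ⟨s, Ioc_subset_Icc_self hs, by rwa [hsy]⟩
  rw [Real.circleAverage_def, smul_eq_mul] at havg
  rw [intervalIntegral.integral_const, sub_zero, smul_eq_mul] at hint
  have h2 := mul_lt_mul_of_pos_left hint (inv_pos.2 Real.two_pi_pos)
  rw [inv_mul_cancel_left₀ Real.two_pi_pos.ne'] at h2
  exact absurd havg (not_le.2 h2)

/-! ### Floer solutions as maps on `ℂ` -/

section

variable {lam : (x : M) → TangentSpace (𝓡∂ (2 * n)) x →L[ℝ] ℝ}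
  {J : (x : M) → TangentSpace (𝓡∂ (2 * n)) x →L[ℝ] TangentSpace (𝓡∂ (2 * n)) x}
  {F f : M → ℂ} {z₀ : ℂ} {α : ℝ} {θ : ℝ → ℝ} {mm mp : M} {γ : ℝ → M} {u : ℝ × ℝ → M}

/-- A map of two real variables as a map of the complex variable `s + it`. -/
def onComplex (u : ℝ × ℝ → M) (z : ℂ) : M :=
  u (z.re, z.im)

theorem IsFloerSolution.contMDiff_onComplex (hu : IsFloerSolution lam J F θ u) :
    ContMDiff 𝓘(ℝ, ℂ) (𝓡∂ (2 * n)) 1 (onComplex u) :=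
  hu.contMDiff.comp Complex.equivRealProdCLM.contDiff.contMDiff

theorem IsFloerSolution.floer_onComplex (hu : IsFloerSolution lam J F θ u) (z : ℂ) :
    mfderiv 𝓘(ℝ, ℂ) (𝓡∂ (2 * n)) (onComplex u) z (1 : ℂ)
      + J (onComplex u z) (mfderiv 𝓘(ℝ, ℂ) (𝓡∂ (2 * n)) (onComplex u) z Complex.I
        + perturbationField lam J F θ z.im (onComplex u z)) = 0 := by
  have h1 : HasMFDerivAt 𝓘(ℝ, ℂ) 𝓘(ℝ, ℝ × ℝ) Complex.equivRealProdCLM z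
      (Complex.equivRealProdCLM : ℂ →L[ℝ] ℝ × ℝ) :=
    Complex.equivRealProdCLM.hasFDerivAt.hasMFDerivAt
  have h2 : HasMFDerivAt 𝓘(ℝ, ℝ × ℝ) (𝓡∂ (2 * n)) u (Complex.equivRealProdCLM z) _ :=
    (hu.contMDiff.mdifferentiableAt (by simp)).hasMFDerivAt
  have h3 : mfderiv 𝓘(ℝ, ℂ) (𝓡∂ (2 * n)) (onComplex u) z = _ := (h2.comp z h1).mfderiv
  have h4 : mfderiv 𝓘(ℝ, ℂ) (𝓡∂ (2 * n)) (onComplex u) z (1 : ℂ)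
      = mfderiv 𝓘(ℝ, ℝ × ℝ) (𝓡∂ (2 * n)) u (z.re, z.im) ((1, 0) : ℝ × ℝ) := by
    rw [h3]; rfl
  have h5 : mfderiv 𝓘(ℝ, ℂ) (𝓡∂ (2 * n)) (onComplex u) z Complex.I
      = mfderiv 𝓘(ℝ, ℝ × ℝ) (𝓡∂ (2 * n)) u (z.re, z.im) ((0, 1) : ℝ × ℝ) := by
    rw [h3]; rfl
  rw [h4, h5]
  exact hu.floer z.re z.im

/-- A flow line is a Floer solution which does not depend on `s`. -/
theorem IsBrokenFlowLine.isFloerSolution (hγ : IsBrokenFlowLine lam J F θ mm mp γ) :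
    IsFloerSolution lam J F θ (fun q => γ q.2) := by
  refine ⟨hγ.contMDiff.comp contDiff_snd.contMDiff, fun s t => ?_⟩
  have h1 : HasMFDerivAt 𝓘(ℝ, ℝ × ℝ) 𝓘(ℝ, ℝ) (Prod.snd : ℝ × ℝ → ℝ) (s, t)
      (ContinuousLinearMap.snd ℝ ℝ ℝ) := hasFDerivAt_snd.hasMFDerivAt
  have h2 : HasMFDerivAt 𝓘(ℝ, ℝ) (𝓡∂ (2 * n)) γ (Prod.snd (s, t)) _ :=
    (hγ.contMDiff.mdifferentiableAt (by simp)).hasMFDerivAt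
  have h3 : mfderiv 𝓘(ℝ, ℝ × ℝ) (𝓡∂ (2 * n)) (fun q : ℝ × ℝ => γ q.2) (s, t) = _ :=
    (h2.comp (s, t) h1).mfderiv
  have h4 : mfderiv 𝓘(ℝ, ℝ × ℝ) (𝓡∂ (2 * n)) (fun q : ℝ × ℝ => γ q.2) (s, t) ((1, 0) : ℝ × ℝ)
      = 0 := by
    rw [h3]
    exact (mfderiv 𝓘(ℝ, ℝ) (𝓡∂ (2 * n)) γ t).map_zero
  have h5 : mfderiv 𝓘(ℝ, ℝ × ℝ) (𝓡∂ (2 * n)) (fun q : ℝ × ℝ => γ q.2) (s, t) ((0, 1) : ℝ × ℝ)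
      = mfderiv 𝓘(ℝ, ℝ) (𝓡∂ (2 * n)) γ t (1 : ℝ) := by
    rw [h3]; rfl
  rw [h4, h5]
  have h6 := congrArg (J (γ t)) (hγ.flow t)
  rw [map_zero] at h6
  exact (zero_add _).trans h6

/-- A maximum principle on flow lines follows from the one on Floer solutions. -/
theorem IsBrokenFlowLine.lt_of_isClosed (hγ : IsBrokenFlowLine lam J F θ mm mp γ) {G : Set M}
    (hG : IsOpen G) {Φ : ℝ → M → ℝ} (hΦ : ContinuousOn (fun q : ℝ × M => Φ q.1 q.2) (univ ×ˢ G))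
    (hloc : ∀ u, IsFloerSolution lam J F θ u → ∀ z, onComplex u z ∈ G →
      IsLocalMax (fun z : ℂ => Φ z.im (onComplex u z)) z →
      ∀ᶠ z' : ℂ in 𝓝 z, Φ z'.im (onComplex u z') = Φ z.im (onComplex u z))
    {a : ℝ} (hcl : IsClosed {t | γ t ∈ G ∧ a ≤ Φ t (γ t)})
    (htop : ∀ᶠ t in atTop, ¬ (γ t ∈ G ∧ a ≤ Φ t (γ t)))
    (hbot : ∀ᶠ t in atBot, ¬ (γ t ∈ G ∧ a ≤ Φ t (γ t))) {t : ℝ} (ht : γ t ∈ G) :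
    Φ t (γ t) < a := by
  have hγc : Continuous γ := hγ.contMDiff.continuous
  refine forall_lt_of_isCompact (φ := fun t => Φ t (γ t)) (hG.preimage hγc) ?_ ?_ ?_ t ht
  · exact hΦ.comp (continuous_id.prodMk hγc).continuousOn fun t ht => ⟨mem_univ _, ht⟩
  · intro t ht hmax
    -- For an s-independent solution, a local maximum in t is one on ℂ; the conclusion is restricted
    -- back to the imaginary axis.
    have him : Tendsto Complex.im (𝓝 (t * Complex.I)) (𝓝 t) := by
      have h := Complex.continuous_im.tendsto (t * Complex.I)
      simpa using h
    have hI : Tendsto (fun t : ℝ => (t * Complex.I : ℂ)) (𝓝 t) (𝓝 (t * Complex.I)) :=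
      (Complex.continuous_ofReal.mul continuous_const).tendsto t
    have h := hloc _ hγ.isFloerSolution (t * Complex.I) (by simpa [onComplex] using ht)
      (by
        have h := him.eventually hmax
        simpa [IsLocalMax, IsMaxFilter, onComplex] using h)
    filter_upwards [hI.eventually h] with t' ht'
    simpa [onComplex] using ht'
  · obtain ⟨T, hT⟩ := eventually_atTop.1 htop
    obtain ⟨T', hT'⟩ := eventually_atBot.1 hbot
    refine (isCompact_Icc (a := T') (b := T)).of_isClosed_subset hcl fun t ht => ⟨?_, ?_⟩
    · by_contra h
      exact hT' t (not_le.1 h).le ht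
    · by_contra h
      exact hT t (not_le.1 h).le ht

/-- The four asymptotic conditions confine the closed superlevel set to a rectangle, so it is
compact and `forall_lt_of_isCompact` applies. -/
theorem IsFloerSolution.lt_of_isClosed (hu : IsFloerSolution lam J F θ u) {G : Set M}
    (hG : IsOpen G) {Φ : ℝ → M → ℝ} (hΦ : ContinuousOn (fun q : ℝ × M => Φ q.1 q.2) (univ ×ˢ G))
    (hloc : ∀ u, IsFloerSolution lam J F θ u → ∀ z, onComplex u z ∈ G →
      IsLocalMax (fun z : ℂ => Φ z.im (onComplex u z)) z →
      ∀ᶠ z' : ℂ in 𝓝 z, Φ z'.im (onComplex u z') = Φ z.im (onComplex u z))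
    {a : ℝ} (hcl : IsClosed {z : ℂ | onComplex u z ∈ G ∧ a ≤ Φ z.im (onComplex u z)})
    (ht_top : ∀ᶠ t in atTop, ∀ s, ¬ (u (s, t) ∈ G ∧ a ≤ Φ t (u (s, t))))
    (ht_bot : ∀ᶠ t in atBot, ∀ s, ¬ (u (s, t) ∈ G ∧ a ≤ Φ t (u (s, t))))
    (hs_top : ∀ᶠ s in atTop, ∀ t, ¬ (u (s, t) ∈ G ∧ a ≤ Φ t (u (s, t))))
    (hs_bot : ∀ᶠ s in atBot, ∀ t, ¬ (u (s, t) ∈ G ∧ a ≤ Φ t (u (s, t))))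
    {z : ℂ} (hz : onComplex u z ∈ G) :
    Φ z.im (onComplex u z) < a := by
  have hc := hu.contMDiff_onComplex.continuous
  refine forall_lt_of_isCompact (φ := fun z : ℂ => Φ z.im (onComplex u z)) (hG.preimage hc)
    ?_ (hloc u hu) ?_ z hz
  · exact hΦ.comp (Complex.continuous_im.prodMk hc).continuousOn fun t ht => ⟨mem_univ _, ht⟩
  · obtain ⟨T, hT⟩ := eventually_atTop.1 ht_top
    obtain ⟨T', hT'⟩ := eventually_atBot.1 ht_bot
    obtain ⟨S, hS⟩ := eventually_atTop.1 hs_top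
    obtain ⟨S', hS'⟩ := eventually_atBot.1 hs_bot
    refine ((isCompact_Icc (a := S') (b := S)).reProdIm
      (isCompact_Icc (a := T') (b := T))).of_isClosed_subset hcl fun z hz => ?_
    refine ⟨⟨?_, ?_⟩, ?_, ?_⟩
    · by_contra h
      exact hS' _ (not_le.1 h).le _ hz
    · by_contra h
      exact hS _ (not_le.1 h).le _ hz
    · by_contra h
      exact hT' _ (not_le.1 h).le _ hz
    · by_contra h
      exact hT _ (not_le.1 h).le _ hz

end

/-! ### The bound in the base -/

/-- A bounded primitive of `c (1 - e^{iθ})` for `θ` of compact support. -/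
theorem exists_bounded_primitive {θ : ℝ → ℝ} (hθ : Continuous θ) {T : ℝ}
    (hT : ∀ t, T ≤ |t| → θ t = 0) (c : ℝ) :
    ∃ (b : ℝ → ℂ) (C : ℝ), (∀ t, HasDerivAt b (c - c * Complex.exp (θ t * Complex.I)) t) ∧
      ∀ t, ‖b t‖ ≤ C := by
  set g : ℝ → ℂ := fun t => c - c * Complex.exp (θ t * Complex.I) with hg
  have hgc : Continuous g := by fun_prop
  have hgs : HasCompactSupport g := by
    refine HasCompactSupport.of_support_subset_isCompact (isCompact_Icc (a := -T) (b := T)) ?_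
    intro t ht
    by_contra h
    refine ht ?_
    have : T ≤ |t| := by
      by_contra h'
      exact h (abs_le.1 (not_le.1 h').le)
    simp [hg, hT t this]
  have hgi : MeasureTheory.Integrable g := hgc.integrable_of_hasCompactSupport hgs
  refine ⟨fun t => ∫ τ in (0 : ℝ)..t, g τ, ∫ τ, ‖g τ‖, fun t => ?_, fun t => ?_⟩
  · exact intervalIntegral.integral_hasDerivAt_right (hgc.intervalIntegrable _ _)
      (hgc.stronglyMeasurableAtFilter _ _) hgc.continuousAt
  · refine intervalIntegral.norm_integral_le_integral_norm_uIoc.trans ?_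
    exact MeasureTheory.setIntegral_le_integral hgi.norm
      (Eventually.of_forall fun _ => norm_nonneg _)

section

variable {lam : (x : M) → TangentSpace (𝓡∂ (2 * n)) x →L[ℝ] ℝ}
  {J : (x : M) → TangentSpace (𝓡∂ (2 * n)) x →L[ℝ] TangentSpace (𝓡∂ (2 * n)) x}
  {F f : M → ℂ} {z₀ : ℂ} {α : ℝ} {θ : ℝ → ℝ} {mm mp : M} {γ γm γp : ℝ → M} {u : ℝ × ℝ → M}

theorem continuous_normalized (hf : Continuous f) (z₀ : ℂ) (α : ℝ) :
    Continuous (normalized f z₀ α) :=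
  continuous_const.mul (hf.sub continuous_const)

/-- Applying dF to the Floer equation gives ∂_t F(u) = i ∂_s F(u) - c e^{iθ(t)}; subtracting b
replaces e^{iθ} by 1. A primitive removing the whole term would be unbounded. -/
theorem IsFloerSolution.eventually_norm_eq_of_isLocalMax
    (hu : IsFloerSolution lam J (normalized f z₀ α) θ u) (hf : IsHolomorphicFunction J f)
    {G : Set M} (hG : IsOpen G) {c : ℝ}
    (hspec : ∀ x ∈ G, ∀ t, Complex.exp (-(α * Complex.I)) * dC n f x
      (perturbationField lam J (normalized f z₀ α) θ t x) = c * Complex.exp (θ t * Complex.I))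
    {b : ℝ → ℂ} (hb : ∀ t, HasDerivAt b (c - c * Complex.exp (θ t * Complex.I)) t)
    {z : ℂ} (hz : onComplex u z ∈ G)
    (hmax : IsLocalMax (fun z : ℂ => ‖normalized f z₀ α (onComplex u z) - b z.im‖) z) :
    ∀ᶠ z' : ℂ in 𝓝 z, ‖normalized f z₀ α (onComplex u z') - b z'.im‖
      = ‖normalized f z₀ α (onComplex u z) - b z.im‖ := by
  set e := Complex.exp (-(α * Complex.I)) with he
  have hc := hu.contMDiff_onComplex.continuous
  have hderiv : ∀ y, HasFDerivAt (fun z : ℂ => normalized f z₀ α (onComplex u z) - b z.im)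
      (e • ((dC n f (onComplex u y)).comp
        (mfderiv 𝓘(ℝ, ℂ) (𝓡∂ (2 * n)) (onComplex u) y) : ℂ →L[ℝ] ℂ)
        - Complex.imCLM.smulRight (c - c * Complex.exp (θ y.im * Complex.I))) y := by
    intro y
    have h1 : HasMFDerivAt 𝓘(ℝ, ℂ) 𝓘(ℝ, ℂ) (f ∘ onComplex u) y
        ((dC n f (onComplex u y)).comp (mfderiv 𝓘(ℝ, ℂ) (𝓡∂ (2 * n)) (onComplex u) y)) :=
      ((hf.smooth _).mdifferentiableAt (by simp)).hasMFDerivAt.comp y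
        (hu.contMDiff_onComplex.mdifferentiableAt (by simp)).hasMFDerivAt
    have h2 : HasFDerivAt (f ∘ onComplex u)
        ((dC n f (onComplex u y)).comp
          (mfderiv 𝓘(ℝ, ℂ) (𝓡∂ (2 * n)) (onComplex u) y) : ℂ →L[ℝ] ℂ) y :=
      hasMFDerivAt_iff_hasFDerivAt.1 h1
    have h3 : HasFDerivAt (fun z : ℂ => b z.im)
        (Complex.imCLM.smulRight (c - c * Complex.exp (θ y.im * Complex.I))) y :=
      HasFDerivAt.comp (g := b) y (hb y.im).hasFDerivAt Complex.imCLM.hasFDerivAt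
    exact ((h2.sub_const z₀).const_mul e).sub h3
  refine LefschetzFloer.eventually_norm_eq_of_isLocalMax (hG.preimage hc) (c := c)
    (fun y _ => (hderiv y).differentiableAt) (fun y hy => ?_) hz hmax
  rw [(hderiv y).fderiv]
  have h1 := congrArg (fun v => e * dC n f (onComplex u y) v) (hu.floer_onComplex y)
  have h2 := hspec _ hy y.im
  simp only [map_add, hf.holomorphic, map_zero, mul_zero] at h1
  have h3 : ∀ ξ : ℂ, (e • ((dC n f (onComplex u y)).comp
        (mfderiv 𝓘(ℝ, ℂ) (𝓡∂ (2 * n)) (onComplex u) y) : ℂ →L[ℝ] ℂ)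
        - Complex.imCLM.smulRight (c - c * Complex.exp (θ y.im * Complex.I))) ξ
      = e * dC n f (onComplex u y) (mfderiv 𝓘(ℝ, ℂ) (𝓡∂ (2 * n)) (onComplex u) y ξ)
        - ξ.im * (c - c * Complex.exp (θ y.im * Complex.I)) := fun ξ => rfl
  rw [h3, h3]
  generalize dC n f (onComplex u y) (mfderiv 𝓘(ℝ, ℂ) (𝓡∂ (2 * n)) (onComplex u) y Complex.I) = B
    at h1 ⊢
  generalize dC n f (onComplex u y) (mfderiv 𝓘(ℝ, ℂ) (𝓡∂ (2 * n)) (onComplex u) y (1 : ℂ)) = A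
    at h1 ⊢
  generalize dC n f (onComplex u y)
    (perturbationField lam J (normalized f z₀ α) θ y.im (onComplex u y)) = V at h1 h2
  simp only [Complex.I_im, Complex.one_im, Complex.ofReal_one, Complex.ofReal_zero]
  linear_combination (-Complex.I) * h1 - h2 + (e * (B + V)) * Complex.I_mul_I

/-- Floer solutions have image in a fixed bounded part of the base. -/
theorem exists_norm_normalized_le (hf : IsHolomorphicFunction J f) {R₀ c : ℝ}
    (hspec : ∀ x, R₀ < ‖normalized f z₀ α x‖ → ∀ t, Complex.exp (-(α * Complex.I)) * dC n f x
      (perturbationField lam J (normalized f z₀ α) θ t x) = c * Complex.exp (θ t * Complex.I))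
    (hθ : Continuous θ) {T : ℝ} (hT : ∀ t, T ≤ |t| → θ t = 0) (mm mp : M) :
    ∃ R : ℝ, ∀ (γm γp : ℝ → M) (u : ℝ × ℝ → M),
      IsBrokenFlowLine lam J (normalized f z₀ α) θ mm mp γm →
      IsBrokenFlowLine lam J (normalized f z₀ α) θ mm mp γp →
      IsFloerSolution lam J (normalized f z₀ α) θ u → HasAsymptotics mm mp γm γp u →
      (∀ t, ‖normalized f z₀ α (γm t)‖ ≤ R) ∧ (∀ t, ‖normalized f z₀ α (γp t)‖ ≤ R) ∧
      ∀ s t, ‖normalized f z₀ α (u (s, t))‖ ≤ R := by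
  obtain ⟨b, C, hb, hC⟩ := exists_bounded_primitive hθ hT c
  set F := normalized f z₀ α with hF
  have hFc : Continuous F := continuous_normalized hf.smooth.continuous z₀ α
  have hbc : Continuous b := continuous_iff_continuousAt.2 fun t => (hb t).continuousAt
  set G : Set M := {x | R₀ < ‖F x‖} with hGdef
  have hG : IsOpen G := isOpen_lt continuous_const hFc.norm
  have hΦ : Continuous (fun q : ℝ × M => ‖F q.2 - b q.1‖) :=
    ((hFc.comp continuous_snd).sub (hbc.comp continuous_fst)).norm
  set Φ : ℝ → M → ℝ := fun t x => ‖F x - b t‖ with hΦdef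
  -- Since Φ and ‖F‖ differ by at most C, Φ ≥ a forces ‖F‖ > R₀, where `hspec` holds, and Φ < a near
  -- both limit points for all t at once.
  set a := max R₀ (max ‖F mm‖ ‖F mp‖) + C + 1 with ha
  have hFΦ : ∀ t x, ‖F x‖ ≤ Φ t x + C := fun t x => by
    have h := norm_add_le (F x - b t) (b t)
    rw [sub_add_cancel] at h
    exact h.trans (by gcongr; exact hC t)
  have hΦF : ∀ t x, Φ t x ≤ ‖F x‖ + C := fun t x =>
    (norm_sub_le _ _).trans (by gcongr; exact hC t)
  have hmem : ∀ a' ≥ a, ∀ t x, a' ≤ Φ t x → x ∈ G := fun a' ha' t x h => by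
    have h1 := hΦF t x
    have h2 : R₀ ≤ max R₀ (max ‖F mm‖ ‖F mp‖) := le_max_left _ _
    change R₀ < ‖F x‖
    linarith
  have hloc : ∀ u, IsFloerSolution lam J F θ u → ∀ z, onComplex u z ∈ G →
      IsLocalMax (fun z : ℂ => Φ z.im (onComplex u z)) z →
      ∀ᶠ z' : ℂ in 𝓝 z, Φ z'.im (onComplex u z') = Φ z.im (onComplex u z) :=
    fun u hu z hz hmax => hu.eventually_norm_eq_of_isLocalMax hf hG hspec hb hz hmax
  have hnhds : ∀ m, ‖F m‖ ≤ max ‖F mm‖ ‖F mp‖ → {x | ∀ t, Φ t x < a} ∈ 𝓝 m := fun m hm => by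
    have h : ∀ᶠ x in 𝓝 m, ‖F x‖ < ‖F m‖ + 1 :=
      (hFc.norm.tendsto m).eventually (gt_mem_nhds (lt_add_one _))
    filter_upwards [h] with x hx t
    have h1 := hΦF t x
    have h2 : max ‖F mm‖ ‖F mp‖ ≤ max R₀ (max ‖F mm‖ ‖F mp‖) := le_max_right _ _
    linarith
  have hnm := hnhds mm (le_max_left _ _)
  have hnp := hnhds mp (le_max_right _ _)
  have hflow : ∀ γ, IsBrokenFlowLine lam J F θ mm mp γ → ∀ t, Φ t (γ t) < a := by
    intro γ hγ t
    by_contra hcon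
    rw [not_lt] at hcon
    refine absurd (hγ.lt_of_isClosed hG hΦ.continuousOn hloc (a := a) ?_ ?_ ?_
      (hmem a le_rfl t _ hcon)) (not_lt.2 hcon)
    · have : {t | γ t ∈ G ∧ a ≤ Φ t (γ t)} = {t | a ≤ Φ t (γ t)} :=
        ext fun t => ⟨fun h => h.2, fun h => ⟨hmem a le_rfl t _ h, h⟩⟩
      rw [this]
      exact isClosed_le continuous_const
        (hΦ.comp (continuous_id.prodMk hγ.contMDiff.continuous))
    · filter_upwards [hγ.lim_top hnm] with t ht h using absurd (ht t) (not_lt.2 h.2)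
    · filter_upwards [hγ.lim_bot hnp] with t ht h using absurd (ht t) (not_lt.2 h.2)
  -- The 1 allows F(u) to differ from F on the limiting flow lines by less than 1; C is the cost of
  -- returning from Φ to ‖F‖.
  refine ⟨a + 1 + C, fun γm γp u hγm hγp hu has => ?_⟩
  have hfl : ∀ γ, IsBrokenFlowLine lam J F θ mm mp γ → ∀ t, ‖F (γ t)‖ ≤ a + 1 + C :=
    fun γ hγ t => by linarith [hFΦ t (γ t), hflow γ hγ t]
  refine ⟨hfl γm hγm, hfl γp hγp, fun s t => ?_⟩
  suffices h : Φ t (u (s, t)) < a + 1 by linarith [hFΦ t (u (s, t))]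
  by_contra hcon
  rw [not_lt] at hcon
  have hdiag : {q : M × M | ‖F q.2 - F q.1‖ < 1} ∈ 𝓝ˢ (diagonal M) := by
    refine (isOpen_lt ((hFc.comp continuous_snd).sub (hFc.comp continuous_fst)).norm
      continuous_const).mem_nhdsSet.2 ?_
    rintro ⟨x, y⟩ (rfl : x = y)
    simp
  have hs : ∀ (γ : ℝ → M) (s : ℝ), IsBrokenFlowLine lam J F θ mm mp γ →
      (∀ t, (γ t, u (s, t)) ∈ {q : M × M | ‖F q.2 - F q.1‖ < 1}) →
      ∀ t, ¬ (u (s, t) ∈ G ∧ a + 1 ≤ Φ t (u (s, t))) := by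
    rintro γ s hγ h t ⟨-, h2⟩
    have h3 : Φ t (u (s, t)) ≤ ‖F (u (s, t)) - F (γ t)‖ + Φ t (γ t) := by
      have := norm_add_le (F (u (s, t)) - F (γ t)) (F (γ t) - b t)
      rwa [sub_add_sub_cancel] at this
    have h4 : ‖F (u (s, t)) - F (γ t)‖ < 1 := h t
    linarith [hflow γ hγ t]
  refine absurd (hu.lt_of_isClosed hG hΦ.continuousOn hloc (a := a + 1) (z := ⟨s, t⟩) ?_ ?_ ?_ ?_ ?_
    (hmem (a + 1) (by linarith) t _ hcon)) (not_lt.2 hcon)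
  · have : {z : ℂ | onComplex u z ∈ G ∧ a + 1 ≤ Φ z.im (onComplex u z)}
        = {z : ℂ | a + 1 ≤ Φ z.im (onComplex u z)} :=
      ext fun z => ⟨fun h => h.2, fun h => ⟨hmem (a + 1) (by linarith) _ _ h, h⟩⟩
    rw [this]
    exact isClosed_le continuous_const
      (hΦ.comp (Complex.continuous_im.prodMk hu.contMDiff_onComplex.continuous))
  · filter_upwards [has.t_top _ hnm] with t ht s h
    linarith [ht s t, h.2]
  · filter_upwards [has.t_bot _ hnp] with t ht s h
    linarith [ht s t, h.2]
  · filter_upwards [has.s_top _ hdiag] with s hs' using hs γm s hγm hs'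
  · filter_upwards [has.s_bot _ hdiag] with s hs' using hs γp s hγp hs'

end

/-! ### The boundary -/

section

variable {lam : (x : M) → TangentSpace (𝓡∂ (2 * n)) x →L[ℝ] ℝ}
  {J : (x : M) → TangentSpace (𝓡∂ (2 * n)) x →L[ℝ] TangentSpace (𝓡∂ (2 * n)) x}
  {F : M → ℂ} {θ : ℝ → ℝ} {u : ℝ × ℝ → M} {W : Set M} {p : M → M}

/-- A holomorphic projection whose differential kills the perturbation field maps Floer solutions
to holomorphic curves. -/
theorem IsFloerSolution.isHolomorphicCurve_comp (hu : IsFloerSolution lam J F θ u)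
    (hJ : ∀ (x : M) (v : TangentSpace (𝓡∂ (2 * n)) x), J x (J x v) = -v)
    (hW : IsOpen W) (hp : ContMDiffOn (𝓡∂ (2 * n)) (𝓡∂ (2 * n)) ∞ p W)
    (hpJ : ∀ x ∈ W, ∀ v : TangentSpace (𝓡∂ (2 * n)) x,
      mfderiv (𝓡∂ (2 * n)) (𝓡∂ (2 * n)) p x (J x v)
        = J (p x) (mfderiv (𝓡∂ (2 * n)) (𝓡∂ (2 * n)) p x v))
    (hpv : ∀ x ∈ W, ∀ t, mfderiv (𝓡∂ (2 * n)) (𝓡∂ (2 * n)) p x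
      (perturbationField lam J F θ t x) = 0)
    {Ω : Set ℂ} (hΩ : MapsTo (onComplex u) Ω W) :
    IsHolomorphicCurve J Ω (p ∘ onComplex u) := by
  refine ⟨(hp.of_le (by simp)).comp hu.contMDiff_onComplex.contMDiffOn hΩ, fun z hz ξ => ?_⟩
  have hx := hΩ hz
  have hd : mfderiv 𝓘(ℝ, ℂ) (𝓡∂ (2 * n)) (p ∘ onComplex u) z = _ :=
    mfderiv_comp z ((hp.contMDiffAt (hW.mem_nhds hx)).mdifferentiableAt (by simp))
      (hu.contMDiff_onComplex.mdifferentiableAt (by simp))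
  -- Under dp the field disappears and J passes through, leaving the Cauchy-Riemann equation on the
  -- basis 1, i; real linearity does the rest.
  have h1 := congrArg (mfderiv (𝓡∂ (2 * n)) (𝓡∂ (2 * n)) p (onComplex u z))
    (hu.floer_onComplex z)
  rw [map_add, hpJ _ hx, map_add, hpv _ hx, add_zero, map_zero] at h1
  rw [hd]
  set L : ℂ →L[ℝ] TangentSpace (𝓡∂ (2 * n)) (p (onComplex u z)) :=
    (mfderiv (𝓡∂ (2 * n)) (𝓡∂ (2 * n)) p (onComplex u z)).comp
      (mfderiv 𝓘(ℝ, ℂ) (𝓡∂ (2 * n)) (onComplex u) z) with hL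
  change L 1 + J (p (onComplex u z)) (L Complex.I) = 0 at h1
  change L (Complex.I * ξ) = J (p (onComplex u z)) (L ξ)
  have h2 : J (p (onComplex u z)) (L 1) = L Complex.I := by
    rw [eq_neg_of_add_eq_zero_left h1, map_neg, hJ, neg_neg]
  have h3 : J (p (onComplex u z)) (L Complex.I) = - L 1 := eq_neg_of_add_eq_zero_right h1
  have hξ : ξ = ξ.re • (1 : ℂ) + ξ.im • Complex.I := by
    simp [Complex.re_add_im]
  have hξ' : Complex.I * ξ = ξ.re • Complex.I - ξ.im • (1 : ℂ) := by
    apply Complex.ext <;> simp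
  rw [hξ', map_sub, map_smul, map_smul]
  conv_rhs => rw [hξ, map_add, map_smul, map_smul, map_add, map_smul, map_smul, h2, h3]
  rw [smul_neg, sub_eq_add_neg]

/-- The principle is for h ∘ p rather than h, since p ∘ u is J-holomorphic while u solves a
perturbed equation. -/
theorem IsFloerSolution.eventually_eq_of_isLocalMax (hu : IsFloerSolution lam J F θ u)
    (hJ : ∀ (x : M) (v : TangentSpace (𝓡∂ (2 * n)) x), J x (J x v) = -v)
    (hW : IsOpen W) (hp : ContMDiffOn (𝓡∂ (2 * n)) (𝓡∂ (2 * n)) ∞ p W)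
    (hpJ : ∀ x ∈ W, ∀ v : TangentSpace (𝓡∂ (2 * n)) x,
      mfderiv (𝓡∂ (2 * n)) (𝓡∂ (2 * n)) p x (J x v)
        = J (p x) (mfderiv (𝓡∂ (2 * n)) (𝓡∂ (2 * n)) p x v))
    (hpv : ∀ x ∈ W, ∀ t, mfderiv (𝓡∂ (2 * n)) (𝓡∂ (2 * n)) p x
      (perturbationField lam J F θ t x) = 0)
    {h : M → ℝ} (hh : Continuous h) {O : Set M} (hpsh : PlurisubharmonicOn J h O)
    {G : Set M} (hG : IsOpen G) (hGW : G ⊆ W) (hGO : MapsTo p G O)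
    {z : ℂ} (hz : onComplex u z ∈ G) (hmax : IsLocalMax (fun z => h (p (onComplex u z))) z) :
    ∀ᶠ z' in 𝓝 z, h (p (onComplex u z')) = h (p (onComplex u z)) := by
  have hc := hu.contMDiff_onComplex.continuous
  have hopen : IsOpen (onComplex u ⁻¹' G) := hG.preimage hc
  refine eventually_eq_of_isLocalMax_of_le_circleAverage hopen ?_ ?_ hz hmax
  · exact hh.comp_continuousOn (hp.continuousOn.comp hc.continuousOn fun z hz => hGW hz)
  · exact hpsh _ _ hopen (hu.isHolomorphicCurve_comp hJ hW hp hpJ hpv fun z hz => hGW hz)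
      fun z hz => hGO hz

end

end LefschetzFloer

end

/-! ### The compact set: a bounded region minus a collar of the boundary -/

open LefschetzFloer

theorem mainTheorem4 (n : ℕ) [NeZero n] (M : Type*) [TopologicalSpace M] [T2Space M]
    [SecondCountableTopology M] [ChartedSpace (EuclideanHalfSpace (2 * n)) M]
    [IsManifold (𝓡∂ (2 * n)) ∞ M]
    (lam : (x : M) → TangentSpace (𝓡∂ (2 * n)) x →L[ℝ] ℝ)
    (J : (x : M) → TangentSpace (𝓡∂ (2 * n)) x →L[ℝ] TangentSpace (𝓡∂ (2 * n)) x)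
    (f : M → ℂ) (z₀ : ℂ) (K : Set M) (K' : Set (M × ℂ)) (r : ℝ)
    (hM : LefschetzFloer.IsExactAlmostKahler lam J)
    (hf : LefschetzFloer.IsHolomorphicFunction J f)
    (hproper : LefschetzFloer.ProperMorse J f)
    (hconvex : LefschetzFloer.WeaklyConvexBoundary J)
    (htriv : LefschetzFloer.TrivialAwayFromCompact lam J f z₀ K K' r)
    (hpos : LefschetzFloer.ConvexPosition n f z₀)
    (mm mp : M) (hmm : mm ∈ LefschetzFloer.critSet n f) (hmp : mp ∈ LefschetzFloer.critSet n f)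
    (α : ℝ)
    (him : (LefschetzFloer.normalized f z₀ α mm).im = (LefschetzFloer.normalized f z₀ α mp).im)
    (him_pos : 0 < (LefschetzFloer.normalized f z₀ α mm).im)
    (ν : ℝ) (hν : ν ∈ Ioo (0 : ℝ) 1) (θ : ℝ → ℝ)
    (hθ : LefschetzFloer.IsSpecialPerturbation
      (Complex.arg (LefschetzFloer.normalized f z₀ α mm))
      (Complex.arg (LefschetzFloer.normalized f z₀ α mp)) ν θ) :
    ∃ Khat : Set M, IsCompact Khat ∧ Khat ⊆ ((𝓡∂ (2 * n)).boundary M)ᶜ ∧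
      ∀ (γm γp : ℝ → M) (u : ℝ × ℝ → M),
        LefschetzFloer.IsBrokenFlowLine lam J (LefschetzFloer.normalized f z₀ α) θ mm mp γm →
        LefschetzFloer.IsBrokenFlowLine lam J (LefschetzFloer.normalized f z₀ α) θ mm mp γp →
        LefschetzFloer.IsFloerSolution lam J (LefschetzFloer.normalized f z₀ α) θ u →
        LefschetzFloer.HasAsymptotics mm mp γm γp u →
        range u ⊆ Khat := by

  have hfc : Continuous f := hf.smooth.continuous
  set F := normalized f z₀ α with hF
  have hFc : Continuous F := continuous_normalized hfc z₀ α
  have hnorm : ∀ x, ‖F x‖ = ‖f x - z₀‖ := fun x => by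
    rw [hF, normalized, norm_mul,
      show -(α * Complex.I) = ((-α : ℝ) : ℂ) * Complex.I by push_cast; ring,
      Complex.norm_exp_ofReal_mul_I, one_mul]
  -- the field away from `K`
  have hspecK : ∀ x ∉ K, ∀ t, Complex.exp (-(α * Complex.I)) * dC n f x
      (perturbationField lam J F θ t x)
        = ((2 * r)⁻¹ : ℝ) * Complex.exp (θ t * Complex.I) := by
    intro x hx t
    obtain ⟨δ, hδ, p, ψ, hT, -, -⟩ := htriv.local_triv (f x)
    have hD : IsOpen (Kᶜ ∩ f ⁻¹' Metric.ball (f x) δ) :=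
      htriv.compact_K.isClosed.isOpen_compl.inter (Metric.isOpen_ball.preimage hfc)
    have hxD : x ∈ Kᶜ ∩ f ⁻¹' Metric.ball (f x) δ := ⟨hx, Metric.mem_ball_self hδ⟩
    have hmem := hT.mapsTo x hxD
    have h := (hT.perturbationField_spec hD htriv.r_pos hM hf hxD (fun c => ?_) α θ t).2
    · rw [h]
      push_cast
      rw [div_eq_inv_mul]
    · have hcont : Continuous fun τ : ℝ => ((p x, f x + τ * c) : M × ℂ) := by fun_prop
      have hopen : IsOpen {q : M × ℂ | q.2 ∈ Metric.ball (f x) δ ∧ q ∉ K'} :=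
        (Metric.isOpen_ball.preimage continuous_snd).inter htriv.compact_K'.isClosed.isOpen_compl
      filter_upwards [hcont.continuousAt.preimage_mem_nhds (hopen.mem_nhds
        (by simpa using hmem.2))] with τ hτ
      exact ⟨hmem.1, hτ⟩
  obtain ⟨R₀, hR₀⟩ : ∃ R₀, ∀ x ∈ K, ‖F x‖ ≤ R₀ :=
    htriv.compact_K.exists_bound_of_continuousOn hFc.continuousOn
  obtain ⟨R, hR⟩ := exists_norm_normalized_le (z₀ := z₀) (α := α) hf (R₀ := R₀)
    (fun x hx t => hspecK x (fun hxK => not_lt.2 (hR₀ x hxK) hx) t) hθ.smooth.continuous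
    hθ.outer mm mp
  have hCc : IsCompact {x | ‖F x‖ ≤ R} := by
    have h := hproper.proper.isCompact_preimage (isCompact_closedBall z₀ R)
    have h2 : {x | ‖F x‖ ≤ R} = f ⁻¹' Metric.closedBall z₀ R := by
      ext x
      simp [hnorm, dist_eq_norm]
    rwa [h2]
  -- the field near the boundary
  obtain ⟨W, O', p, ψ, hW, hbW, hO', hbO', hT, hpJ⟩ := htriv.boundary_triv
  have hO'ev : ∀ x ∈ W, ∀ c : ℂ,
      ∀ᶠ τ : ℝ in 𝓝 0, (p x, f x + τ * c) ∈ {q : M × ℂ | f q.1 = z₀ ∧ q ∈ O'} := by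
    intro x hx c
    have hmem := hT.mapsTo x hx
    have hcont : Continuous fun τ : ℝ => ((p x, f x + τ * c) : M × ℂ) := by fun_prop
    filter_upwards [hcont.continuousAt.preimage_mem_nhds (hO'.mem_nhds
      (by simpa using hmem.2))] with τ hτ
    exact ⟨hmem.1, hτ⟩
  have hpv : ∀ x ∈ W, ∀ t, mfderiv (𝓡∂ (2 * n)) (𝓡∂ (2 * n)) p x
      (perturbationField lam J F θ t x) = 0 := fun x hx t =>
    (hT.perturbationField_spec hW htriv.r_pos hM hf hx (hO'ev x hx) α θ t).1
  -- Horizontal lifts make df surjective on `W`, so the limits for t → ±∞ stay away from the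
  -- boundary.
  have hcrit : ∀ x ∈ critSet n f, x ∉ W := by
    intro x hx hxW
    obtain ⟨X, -, hX⟩ := hT.exists_lift hW hf.smooth hxW 1 (hO'ev x hxW 1)
    rw [show dC n f x = 0 from hx] at hX
    exact zero_ne_one hX
  obtain ⟨h, hh, hh0, hhb, O, hO, hbO, hpsh⟩ := hconvex
  have hbclosed : IsClosed ((𝓡∂ (2 * n)).boundary M) := by
    have : (𝓡∂ (2 * n)).boundary M = h ⁻¹' {0} := by
      ext x
      exact (hhb x).symm
    rw [this]
    exact isClosed_singleton.preimage hh
  have hhp : ContinuousOn (fun x => h (p x)) W := hh.comp_continuousOn hT.smooth.continuousOn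
  have : LocallyCompactSpace M := Manifold.locallyCompact_of_finiteDimensional (𝓡∂ (2 * n))
  obtain ⟨N, hN, hbN, hNW⟩ := normal_exists_closure_subset hbclosed
    (hT.smooth.continuousOn.isOpen_inter_preimage hW hO)
    (fun x hx => ⟨hbW hx, hbO ((hT.boundary x (hbW hx)).2 hx)⟩)
  have hNW' : closure N ⊆ W := fun x hx => (hNW hx).1
  -- On the frontier of `N` in the bounded region, which is compact and misses ∂M, h ∘ p is bounded
  -- away from 0.
  obtain ⟨ε, hε, hεN⟩ : ∃ ε > 0, ∀ x, ‖F x‖ ≤ R → x ∈ closure N → x ∉ N → h (p x) < -ε := by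
    have hcpt : IsCompact ({x | ‖F x‖ ≤ R} ∩ (closure N ∩ Nᶜ)) :=
      hCc.inter_right (isClosed_closure.inter hN.isClosed_compl)
    rcases ({x | ‖F x‖ ≤ R} ∩ (closure N ∩ Nᶜ)).eq_empty_or_nonempty with he | hne
    · exact ⟨1, one_pos, fun x h1 h2 h3 => absurd ⟨h1, h2, h3⟩
        (eq_empty_iff_forall_notMem.1 he x)⟩
    · obtain ⟨y, hy, hmax⟩ := hcpt.exists_isMaxOn hne
        (hhp.mono fun x hx => hNW' hx.2.1)
      have hneg : h (p y) < 0 := by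
        refine lt_of_le_of_ne (hh0 _) fun h0 => hy.2.2 (hbN ?_)
        exact (hT.boundary y (hNW' hy.2.1)).1 ((hhb _).1 h0)
      refine ⟨-h (p y) / 2, by linarith, fun x h1 h2 h3 => ?_⟩
      have h4 : h (p x) ≤ h (p y) := hmax ⟨h1, h2, h3⟩
      linarith
  -- By the choice of ε, a superlevel set of h ∘ p in `A` above a level a > -ε cannot reach the
  -- frontier of `N` in the bounded region, so it is closed in M.
  set A : Set M := N ∩ (fun x => h (p x)) ⁻¹' Ioi (-ε) with hA
  have hAopen : IsOpen A :=
    (hhp.mono (subset_closure.trans hNW')).isOpen_inter_preimage hN isOpen_Ioi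
  have hAW : A ⊆ W := fun x hx => hNW' (subset_closure hx.1)
  have hAb : (𝓡∂ (2 * n)).boundary M ⊆ A := fun x hx => ⟨hbN hx, by
    have h1 : h (p x) = 0 := (hhb _).2 ((hT.boundary x (hbW hx)).2 hx)
    change -ε < h (p x)
    linarith⟩
  have hAcl : ∀ a > -ε, {x | ‖F x‖ ≤ R ∧ x ∈ A ∧ a ≤ h (p x)}
      = {x | ‖F x‖ ≤ R} ∩ (closure N ∩ (fun x => h (p x)) ⁻¹' Ici a) := by
    intro a ha
    ext x
    refine ⟨fun hx => ⟨hx.1, subset_closure hx.2.1.1, hx.2.2⟩, fun hx => ?_⟩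
    have h1 : a ≤ h (p x) := hx.2.2
    refine ⟨hx.1, ⟨?_, ha.trans_le h1⟩, h1⟩
    by_contra hxN
    linarith [hεN x hx.1 hx.2.1 hxN]
  have hAclosed : ∀ a > -ε, IsClosed {x | ‖F x‖ ≤ R ∧ x ∈ A ∧ a ≤ h (p x)} := by
    intro a ha
    rw [hAcl a ha]
    exact hCc.isClosed.inter
      ((hhp.mono hNW').preimage_isClosed_of_isClosed isClosed_closure isClosed_Ici)
  have hloc : ∀ u, IsFloerSolution lam J F θ u → ∀ z, onComplex u z ∈ A →
      IsLocalMax (fun z : ℂ => h (p (onComplex u z))) z →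
      ∀ᶠ z' : ℂ in 𝓝 z, h (p (onComplex u z')) = h (p (onComplex u z)) :=
    fun u hu z hz hmax => hu.eventually_eq_of_isLocalMax hM.J_sq hW hT.smooth hpJ hpv hh hpsh
      hAopen hAW (fun x hx => (hNW (subset_closure hx.1)).2) hz hmax
  have hΦ : ContinuousOn (fun q : ℝ × M => h (p q.2)) (univ ×ˢ A) :=
    (hhp.mono hAW).comp continuousOn_snd fun q hq => hq.2
  have hnhds : ∀ m ∈ critSet n f, Aᶜ ∈ 𝓝 m := fun m hm =>
    mem_of_superset (isClosed_closure.isOpen_compl.mem_nhds fun hmN => hcrit m hm (hNW' hmN))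
      fun x hx hxA => hx (subset_closure hxA.1)
  refine ⟨{x | ‖F x‖ ≤ R} ∩ Aᶜ, hCc.inter_right hAopen.isClosed_compl,
    fun x hx hxb => hx.2 (hAb hxb), ?_⟩
  rintro γm γp u hγm hγp hu has _ ⟨⟨s₁, t₁⟩, rfl⟩
  obtain ⟨hRm, hRp, hRu⟩ := hR γm γp u hγm hγp hu has
  have hflow : ∀ γ, IsBrokenFlowLine lam J F θ mm mp γ → (∀ t, ‖F (γ t)‖ ≤ R) →
      ∀ t, γ t ∉ A := by
    intro γ hγ hγR t ht
    -- The threshold is the value at the supposed point of `A` itself, so the strict bound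
    -- contradicts itself there.
    refine lt_irrefl (h (p (γ t)))
      (hγ.lt_of_isClosed (Φ := fun _ x => h (p x)) hAopen hΦ hloc (a := h (p (γ t))) ?_ ?_ ?_ ht)
    · have h1 : {t' | γ t' ∈ A ∧ h (p (γ t)) ≤ h (p (γ t'))}
          = γ ⁻¹' {x | ‖F x‖ ≤ R ∧ x ∈ A ∧ h (p (γ t)) ≤ h (p x)} :=
        ext fun t' => ⟨fun hx => ⟨hγR t', hx⟩, fun hx => hx.2⟩
      rw [h1]
      exact (hAclosed _ ht.2).preimage hγ.contMDiff.continuous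
    · filter_upwards [hγ.lim_top (hnhds mm hmm)] with t' ht' hx using ht' hx.1
    · filter_upwards [hγ.lim_bot (hnhds mp hmp)] with t' ht' hx using ht' hx.1
  refine ⟨hRu s₁ t₁, fun hmem => ?_⟩
  set a := h (p (u (s₁, t₁))) with ha
  have haε : -ε < a := hmem.2
  -- Flow lines avoid `A`, so for large |s| this neighbourhood of the diagonal forces u(s, t) out of
  -- the closed superlevel set, for all t.
  have hdiag : {q : M × M | q.1 ∈ A ∨ q.2 ∉ {x | ‖F x‖ ≤ R ∧ x ∈ A ∧ a ≤ h (p x)}}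
      ∈ 𝓝ˢ (diagonal M) := by
    refine ((hAopen.preimage continuous_fst).union
      ((hAclosed a haε).isOpen_compl.preimage continuous_snd)).mem_nhdsSet.2 ?_
    rintro ⟨x, y⟩ (rfl : x = y)
    by_cases hx : x ∈ A
    · exact Or.inl hx
    · exact Or.inr fun hx' => hx hx'.2.1
  refine lt_irrefl a (hu.lt_of_isClosed (Φ := fun _ x => h (p x)) hAopen hΦ hloc (a := a) (z := ⟨s₁, t₁⟩)
    ?_ ?_ ?_ ?_ ?_ hmem)
  · have h1 : {z : ℂ | onComplex u z ∈ A ∧ a ≤ h (p (onComplex u z))}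
        = onComplex u ⁻¹' {x | ‖F x‖ ≤ R ∧ x ∈ A ∧ a ≤ h (p x)} :=
      ext fun z => ⟨fun hx => ⟨hRu _ _, hx⟩, fun hx => hx.2⟩
    rw [h1]
    exact (hAclosed a haε).preimage hu.contMDiff_onComplex.continuous
  · filter_upwards [has.t_top _ (hnhds mm hmm)] with t ht s hx using ht s hx.1
  · filter_upwards [has.t_bot _ (hnhds mp hmp)] with t ht s hx using ht s hx.1
  · filter_upwards [has.s_top _ hdiag] with s hs t hx
    exact (hs t).elim (hflow γm hγm hRm t) fun h' => h' ⟨hRu s t, hx⟩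
  · filter_upwards [has.s_bot _ hdiag] with s hs t hx
    exact (hs t).elim (hflow γp hγp hRp t) fun h' => h' ⟨hRu s t, hx⟩
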